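/- Let $k$ be a field. For $n\ge 0$ let $(A_{PL})_n = k[t_0,\dots,t_n,dt_0,\dots,dt_n]/(1-\sum_a t_a,\ \sum_a dt_a)$ be the graded commutative algebra with $\deg t_a=0$, $\deg dt_a=1$ (so $dt_a\,dt_b=-dt_b\,dt_a$ and $dt_a^2=0$), let $(A_{PL})_n^i$ be its part of degree $i$, and for $0\le l\le n$, $n\geq 1$, let $\delta^{l,n}\colon (A_{PL})_n\to (A_{PL})_{n-1}$ be the face map that sends $t_l$ and $dt_l$ to $0$ and renumbers the remaining generators in increasing order. For a semicosimplicial complex $V^\Delta=(V_n^\bullet)_{n\ge0}$ of $k$-vector spaces with coface maps $\partial_{l,n}\colon V_{n-1}^\bullet\to V_n^\bullet$ put $$C^{i,j}_{\mathrm{TW}}(V^\Delta)=\Big\{(x_n)_n\in\prod_{n\ge 0}(A_{PL})_n^i\otimes_k V_n^j\ \Big|\ (\delta^{l,n}\otimes\mathrm{Id})(x_n)=(\mathrm{Id}\otimes\partial_{l,n})(x_{n-1})\ \text{for all } n\ge 1,\ 0\le l\le n\Big\}.$$ Let $X$ be a separated $k$-scheme of finite type, let $\mathcal U=\{U_1,\dots,U_r\}$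 be a finite cover of $X$ by affine open subschemes, and let $\mathcal F^\bullet$ be a complex of quasi-coherent $\mathcal O_X$-modules. Let $\mathcal F^\bullet(\mathcal U)$ be the Čech semicosimplicial complex of sheaves, whose $n$-th term has sections $\prod_{a_0<\dots<a_n}\mathcal F^\bullet(V\cap U_{a_0}\cap\dots\cap U_{a_n})$ over an open set $V\subseteq X$, with the usual restriction maps as cofaces, and let $C^{i,j}_{\mathrm{TW}}(\mathcal F^\bullet(\mathcal U))$ be the presheaf of $k$-vector spaces $V\mapsto C^{i,j}_{\mathrm{TW}}(\mathcal F^\bullet(\mathcal U)(V))$. Then for all $i\ge 0$ and $j\in\mathbb Z$ this presheaf is a sheaf, and $$H^\ell\big(X,\,C^{i,j}_{\mathrm{TW}}(\mathcal F^\bullet(\mathcal U))\big)=0\qquad\text{for all }\ell\ge 1.$$ -/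

import Mathlib

universe u

open CategoryTheory AlgebraicGeometry Opposite TopologicalSpace
open scoped TensorProduct

noncomputable section

namespace ThomWhitney

/-! ### Polynomial differential forms on the algebraic simplices -/

section Forms

variable (k : Type u) [CommRing k]

/-- The free associative `k`-algebra on symbols `t_0, …, t_n` (left summand) and
`dt_0, …, dt_n` (right summand). -/
abbrev FreeForms (n : ℕ) : Type u := FreeAlgebra k (Fin (n + 1) ⊕ Fin (n + 1))

variable {k} in
/-- The symbol `t_a`. -/
abbrev FreeForms.t {n : ℕ} (a : Fin (n + 1)) : FreeForms k n := FreeAlgebra.ι k (Sum.inl a)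

variable {k} in
/-- The symbol `dt_a`. -/
abbrev FreeForms.dt {n : ℕ} (a : Fin (n + 1)) : FreeForms k n := FreeAlgebra.ι k (Sum.inr a)

/-- The relations of the graded commutative polynomial ring on `t_a` (degree `0`) and `dt_a`
(degree `1`), together with `∑ t_a = 1` and `∑ dt_a = 0`. -/
inductive FormsRel (n : ℕ) : FreeForms k n → FreeForms k n → Prop where
  | t_comm (a b : Fin (n + 1)) :
      FormsRel n (FreeForms.t a * FreeForms.t b) (FreeForms.t b * FreeForms.t a)
  | t_dt_comm (a b : Fin (n + 1)) :
      FormsRel n (FreeForms.t a * FreeForms.dt b) (FreeForms.dt b * FreeForms.t a)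
  | dt_anticomm (a b : Fin (n + 1)) :
      FormsRel n (FreeForms.dt a * FreeForms.dt b) (-(FreeForms.dt b * FreeForms.dt a))
  | dt_sq (a : Fin (n + 1)) : FormsRel n (FreeForms.dt a * FreeForms.dt a) 0
  | sum_t : FormsRel n (∑ a, FreeForms.t a) 1
  | sum_dt : FormsRel n (∑ a, FreeForms.dt a) 0

/-- `(A_PL)_n = k[t_0, …, t_n, dt_0, …, dt_n] / (1 - ∑ t_a, ∑ dt_a)`, the algebra of differential
forms on the hyperplane `t_0 + ⋯ + t_n = 1` of affine `(n + 1)`-space. -/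
def APL (n : ℕ) : Type u := RingQuot (FormsRel k n)

instance (n : ℕ) : Ring (APL k n) := inferInstanceAs (Ring (RingQuot (FormsRel k n)))

instance (n : ℕ) : Algebra k (APL k n) := inferInstanceAs (Algebra k (RingQuot (FormsRel k n)))

namespace APL

/-- The quotient map from the free algebra. -/
def mk (n : ℕ) : FreeForms k n →ₐ[k] APL k n := RingQuot.mkAlgHom k (FormsRel k n)

variable {k}

/-- The coordinate function `t_a`. -/
def t {n : ℕ} (a : Fin (n + 1)) : APL k n := mk k n (FreeForms.t a)

/-- The differential `dt_a`. -/
def dt {n : ℕ} (a : Fin (n + 1)) : APL k n := mk k n (FreeForms.dt a)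

lemma mk_rel {n : ℕ} {x y : FreeForms k n} (h : FormsRel k n x y) : mk k n x = mk k n y :=
  RingQuot.mkAlgHom_rel k h

lemma t_comm {n : ℕ} (a b : Fin (n + 1)) : (t a * t b : APL k n) = t b * t a := by
  simpa using! mk_rel (FormsRel.t_comm (k := k) a b)

lemma t_dt_comm {n : ℕ} (a b : Fin (n + 1)) : (t a * dt b : APL k n) = dt b * t a := by
  simpa using! mk_rel (FormsRel.t_dt_comm (k := k) a b)

lemma dt_anticomm {n : ℕ} (a b : Fin (n + 1)) : (dt a * dt b : APL k n) = -(dt b * dt a) := by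
  simpa using! mk_rel (FormsRel.dt_anticomm (k := k) a b)

lemma dt_sq {n : ℕ} (a : Fin (n + 1)) : (dt a * dt a : APL k n) = 0 := by
  simpa using! mk_rel (FormsRel.dt_sq (k := k) a)

lemma sum_t (n : ℕ) : ∑ a, (t a : APL k n) = 1 := by
  simpa using! mk_rel (FormsRel.sum_t (k := k) (n := n))

lemma sum_dt (n : ℕ) : ∑ a, (dt a : APL k n) = 0 := by
  simpa using! mk_rel (FormsRel.sum_dt (k := k) (n := n))

/-- The face map `δ^{l} : (A_PL)_{n+1} → (A_PL)_n`, the restriction to the coordinate hyperplane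
`t_l = 0`: it sends `t_l` and `dt_l` to `0` and renumbers the other generators in increasing
order. -/
def face {n : ℕ} (l : Fin (n + 2)) : APL k (n + 1) →ₐ[k] APL k n :=
  RingQuot.liftAlgHom k ⟨FreeAlgebra.lift k
    (Sum.elim (l.insertNth (α := fun _ ↦ APL k n) 0 t)
      (l.insertNth (α := fun _ ↦ APL k n) 0 dt)), by
    intro x y h
    induction h with
    | t_comm a b =>
      cases a using l.succAboveCases <;> cases b using l.succAboveCases <;> simp [t_comm]
    | t_dt_comm a b =>
      cases a using l.succAboveCases <;> cases b using l.succAboveCases <;> simp [t_dt_comm]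
    | dt_anticomm a b =>
      cases a using l.succAboveCases <;> cases b using l.succAboveCases <;>
        simp [← dt_anticomm]
    | dt_sq a => cases a using l.succAboveCases <;> simp [dt_sq]
    | sum_t => simp [Fin.sum_univ_succAbove _ l, sum_t]
    | sum_dt => simp [Fin.sum_univ_succAbove _ l, sum_dt]⟩

lemma face_t {n : ℕ} (l a : Fin (n + 2)) :
    face l (t a : APL k (n + 1)) = l.insertNth (α := fun _ ↦ APL k n) 0 t a := by
  simp only [face, t, mk]
  erw [RingQuot.liftAlgHom_mkAlgHom_apply]
  simp

lemma face_dt {n : ℕ} (l a : Fin (n + 2)) :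
    face l (dt a : APL k (n + 1)) = l.insertNth (α := fun _ ↦ APL k n) 0 dt a := by
  simp only [face, dt, mk]
  erw [RingQuot.liftAlgHom_mkAlgHom_apply]
  simp

variable (k)

/-- The graded piece `(A_PL)_n^i`: the `k`-span of the forms `p · dt_{a_1} ⋯ dt_{a_i}` with `p` a
polynomial in the `t_a`. -/
def deg (n i : ℕ) : Submodule k (APL k n) :=
  Subalgebra.toSubmodule (Algebra.adjoin k (Set.range t)) * Submodule.span k (Set.range dt) ^ i

lemma map_face_deg_le {n : ℕ} (l : Fin (n + 2)) (i : ℕ) :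
    (deg k (n + 1) i).map (face l).toLinearMap ≤ deg k n i := by
  unfold deg
  rw [Submodule.map_mul, Submodule.map_pow]
  refine mul_le_mul' ?_ (pow_le_pow_left' ?_ i)
  · rw [← Subalgebra.map_toSubmodule]
    refine Subalgebra.toSubmodule.monotone ?_
    rw [AlgHom.map_adjoin]
    refine Algebra.adjoin_le ?_
    rintro _ ⟨_, ⟨a, rfl⟩, rfl⟩
    rw [face_t]
    cases a using l.succAboveCases with
    | x => simp
    | p b => simpa using Algebra.subset_adjoin (Set.mem_range_self b)
  · rw [Submodule.map_span, Submodule.span_le]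
    rintro _ ⟨_, ⟨a, rfl⟩, rfl⟩
    rw [AlgHom.toLinearMap_apply, face_dt]
    cases a using l.succAboveCases with
    | x => simp
    | p b => simpa using Submodule.subset_span (Set.mem_range_self b)

/-- The face map on forms of degree `i`. -/
def faceDeg {n : ℕ} (l : Fin (n + 2)) (i : ℕ) : deg k (n + 1) i →ₗ[k] deg k n i :=
  (face l).toLinearMap.restrict fun _ hx ↦
    map_face_deg_le k l i (Submodule.mem_map_of_mem hx)

end APL

end Forms

/-! ### The Thom–Whitney construction for semicosimplicial complexes of modules -/

section Modules

/-- The coface map `[n] → [n + 1]` of the category of finite ordinals and order-preserving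
injections, omitting the value `l`. -/
def coface {n : ℕ} (l : Fin (n + 2)) : SemiSimplexCategory.mk n ⟶ SemiSimplexCategory.mk (n + 1) :=
  SemiSimplexCategory.homEquiv.symm (Fin.succAboveOrderEmb l)

/-- Semicosimplicial objects. -/
abbrev Semicosimplicial (C : Type*) [Category C] := SemiSimplexCategory ⥤ C

variable {k : Type u} [CommRing k]

/-- `C^{i,j}_TW(V^Δ)`: the families `(x_n)_n` with `x_n ∈ (A_PL)_n^i ⊗ V_n^j` such that
`(δ^l ⊗ id) x_{n+1} = (id ⊗ ∂_l) x_n` for all `n` and all `0 ≤ l ≤ n + 1`. -/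
def C (V : Semicosimplicial (CochainComplex (ModuleCat.{u} k) ℤ)) (i : ℕ) (j : ℤ) :
    Submodule k (∀ n : ℕ, APL.deg k n i ⊗[k] (V.obj (.mk n)).X j) where
  carrier := {x | ∀ (n : ℕ) (l : Fin (n + 2)),
    (APL.faceDeg k l i).rTensor ((V.obj (.mk (n + 1))).X j) (x (n + 1)) =
      ((V.map (coface l)).f j).hom.lTensor (APL.deg k n i) (x n)}
  add_mem' hx hy n l := by simp [hx n l, hy n l]
  zero_mem' n l := by simp
  smul_mem' c x hx n l := by simp [hx n l]

/-- Functoriality of the Thom–Whitney construction. -/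
def mapC {V W : Semicosimplicial (CochainComplex (ModuleCat.{u} k) ℤ)} (φ : V ⟶ W)
    (i : ℕ) (j : ℤ) : C V i j →ₗ[k] C W i j :=
  LinearMap.restrict
    (LinearMap.pi fun n ↦
      (((φ.app (.mk n)).f j).hom.lTensor (APL.deg k n i)).comp (LinearMap.proj n))
    (by
      intro x hx n l
      have h := congr($(φ.naturality (coface l)).f j)
      have h' := congr(ModuleCat.Hom.hom $h)
      simp only [HomologicalComplex.comp_f, ModuleCat.hom_comp] at h'
      have hx' := hx n l
      simp only [LinearMap.pi_apply, LinearMap.comp_apply, LinearMap.proj_apply]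
      rw [← LinearMap.comp_apply, LinearMap.rTensor_comp_lTensor,
        ← LinearMap.lTensor_comp_rTensor, LinearMap.comp_apply, hx', ← LinearMap.comp_apply,
        ← LinearMap.comp_apply, ← LinearMap.lTensor_comp, ← LinearMap.lTensor_comp, h'])

instance (V : Semicosimplicial (CochainComplex (ModuleCat.{u} k) ℤ)) (i : ℕ) (j : ℤ) :
    AddCommGroup (C V i j) :=
  Submodule.addCommGroup (M := ∀ n : ℕ, APL.deg k n i ⊗[k] (V.obj (.mk n)).X j) (C V i j)

instance (V : Semicosimplicial (CochainComplex (ModuleCat.{u} k) ℤ)) (i : ℕ) (j : ℤ) :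
    Module k (C V i j) :=
  Submodule.module (M := ∀ n : ℕ, APL.deg k n i ⊗[k] (V.obj (.mk n)).X j) (C V i j)

variable (k) in
/-- The Thom–Whitney construction as a functor. -/
def functorC (i : ℕ) (j : ℤ) :
    Semicosimplicial (CochainComplex (ModuleCat.{u} k) ℤ) ⥤ ModuleCat.{u} k where
  obj V := ModuleCat.of k (C V i j)
  map φ := ModuleCat.ofHom (mapC φ i j)
  map_id V := by
    ext x : 2
    refine Subtype.ext (funext fun n ↦ ?_)
    simp [mapC]
  map_comp φ ψ := by
    ext x : 2
    refine Subtype.ext (funext fun n ↦ ?_)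
    simp [mapC, LinearMap.lTensor_comp]
    rfl

end Modules

/-! ### The Thom–Whitney construction for (pre)sheaves -/

section Presheaves

variable {k : Type u} [CommRing k] {X : TopCat.{u}}

/-- The semicosimplicial complex of sections of a semicosimplicial complex of presheaves over each
open set, as a functor of the open set. -/
def sections (F : Semicosimplicial (CochainComplex (TopCat.Presheaf (ModuleCat.{u} k) X) ℤ)) :
    (Opens X)ᵒᵖ ⥤ Semicosimplicial (CochainComplex (ModuleCat.{u} k) ℤ) where
  obj V := F ⋙ ((evaluation (Opens X)ᵒᵖ (ModuleCat.{u} k)).obj V).mapHomologicalComplex _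
  map g := Functor.whiskerLeft F
    (NatTrans.mapHomologicalComplex ((evaluation (Opens X)ᵒᵖ (ModuleCat.{u} k)).map g) _)
  map_id V := by
    ext n p : 4
    simp
  map_comp g h := by
    ext n p : 4
    simp

/-- The presheaf `V ↦ C^{i,j}_TW(F^Δ(V))`. -/
def presheafC (F : Semicosimplicial (CochainComplex (TopCat.Presheaf (ModuleCat.{u} k) X) ℤ))
    (i : ℕ) (j : ℤ) : TopCat.Presheaf (ModuleCat.{u} k) X :=
  sections F ⋙ functorC k i j

variable {r : ℕ} (U : Fin r → Opens X)

/-- The intersection `U_{σ(0)} ∩ ⋯ ∩ U_{σ(n)}`. -/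
def inter {n : ℕ} (σ : Fin (n + 1) ↪o Fin r) : Opens X := ⨅ a, U (σ a)

lemma inter_le {m n : ℕ} (φ : Fin (m + 1) ↪o Fin (n + 1)) (σ : Fin (n + 1) ↪o Fin r) :
    inter U σ ≤ inter U (φ.trans σ) :=
  le_iInf fun a ↦ iInf_le _ (φ a)

/-- The functor `P ↦ ∏_{i_0 < ⋯ < i_n} P(U_{i_0 ⋯ i_n})`, where `P(W)` for an open set `W` stands
for the presheaf `V ↦ P(V ∩ W)`, i.e. for `j_* (P|_W)` with `j : W → X` the inclusion. -/
def cechTerm (n : ℕ) :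
    TopCat.Presheaf (ModuleCat.{u} k) X ⥤ TopCat.Presheaf (ModuleCat.{u} k) X where
  obj P :=
    { obj V := ModuleCat.of k (∀ σ : Fin (n + 1) ↪o Fin r, P.obj (op (V.unop ⊓ inter U σ)))
      map {V W} g := ModuleCat.ofHom (LinearMap.pi fun σ ↦
        (P.map (homOfLE (inf_le_inf_right (inter U σ) g.unop.le)).op).hom.comp
          (LinearMap.proj σ))
      map_id V := by
        refine ModuleCat.hom_ext (LinearMap.ext fun x ↦ funext fun σ ↦ ?_)
        exact congr($(P.map_id _) (x σ))
      map_comp g h := by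
        refine ModuleCat.hom_ext (LinearMap.ext fun x ↦ funext fun σ ↦ ?_)
        exact congr($(P.map_comp _ _) (x σ)) }
  map {P Q} f :=
    { app V := ModuleCat.ofHom (LinearMap.pi fun σ ↦
        (f.app (op (V.unop ⊓ inter U σ))).hom.comp (LinearMap.proj σ))
      naturality V W g := by
        refine ModuleCat.hom_ext (LinearMap.ext fun x ↦ funext fun σ ↦ ?_)
        exact congr($(f.naturality _) (x σ)) }
  map_id P := rfl
  map_comp f g := rfl

instance (n : ℕ) : (cechTerm (k := k) U n).Additive where
  map_add := rfl

/-- The Čech maps: for an order-preserving injection `φ : [m] → [n]`, the map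
`∏ P(U_{i_0 ⋯ i_m}) → ∏ P(U_{i_0 ⋯ i_n})` whose component at `σ = (i_0 < ⋯ < i_n)` is the
restriction of the component at `σ ∘ φ`. -/
def cechMap {m n : ℕ} (φ : Fin (m + 1) ↪o Fin (n + 1)) :
    cechTerm (k := k) U m ⟶ cechTerm (k := k) U n where
  app P :=
    { app V := ModuleCat.ofHom (LinearMap.pi fun σ ↦
        (P.map (homOfLE (inf_le_inf_left V.unop (inter_le U φ σ))).op).hom.comp
          (LinearMap.proj (φ.trans σ)))
      naturality V W g := by
        refine ModuleCat.hom_ext (LinearMap.ext fun x ↦ funext fun σ ↦ ?_)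
        have h := (P.map_comp (homOfLE (inf_le_inf_right (inter U (φ.trans σ)) g.unop.le)).op
          (homOfLE (inf_le_inf_left W.unop (inter_le U φ σ))).op).symm.trans
          (P.map_comp (homOfLE (inf_le_inf_left V.unop (inter_le U φ σ))).op
            (homOfLE (inf_le_inf_right (inter U σ) g.unop.le)).op)
        exact congr($h (x (φ.trans σ))) }
  naturality P Q f := by
    ext V x : 4
    refine funext fun σ ↦ ?_
    exact congr($((f.naturality _).symm) (x (φ.trans σ)))

lemma cechMap_refl (n : ℕ) : cechMap (k := k) U (m := n) (RelEmbedding.refl (· ≤ ·)) = 𝟙 _ := by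
  ext P V x : 6
  refine funext fun σ ↦ ?_
  exact congr($(P.map_id _) (x σ))

lemma cechMap_comp {l m n : ℕ} (φ : Fin (l + 1) ↪o Fin (m + 1)) (ψ : Fin (m + 1) ↪o Fin (n + 1)) :
    cechMap (k := k) U (φ.trans ψ) = cechMap U φ ≫ cechMap U ψ := by
  ext P V x : 6
  refine funext fun σ ↦ ?_
  have h := P.map_comp
    (homOfLE (inf_le_inf_left V (inter_le U φ (ψ.trans σ)))).op
    (homOfLE (inf_le_inf_left V (inter_le U ψ σ))).op
  exact congr($h (x (φ.trans (ψ.trans σ))))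

/-- The Čech semicosimplicial complex `F^•(𝒰)` of a complex of presheaves `F^•` and a finite
family of open sets `𝒰`. -/
def cech (F : CochainComplex (TopCat.Presheaf (ModuleCat.{u} k) X) ℤ) :
    Semicosimplicial (CochainComplex (TopCat.Presheaf (ModuleCat.{u} k) X) ℤ) where
  obj n := ((cechTerm U n.len).mapHomologicalComplex _).obj F
  map φ := (NatTrans.mapHomologicalComplex (cechMap U (SemiSimplexCategory.homEquiv φ)) _).app F
  map_id n := by
    rw [SemiSimplexCategory.homEquiv_id, cechMap_refl]
    rfl
  map_comp φ ψ := by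
    rw [SemiSimplexCategory.homEquiv_comp, cechMap_comp]
    rfl

end Presheaves

/-! ### Complexes of `𝒪_X`-modules on a `k`-scheme -/

section Schemes

variable {k : Type u} [CommRing k] {X : Scheme.{u}} (f : X ⟶ Spec (CommRingCat.of k))

/-- The ring homomorphism `k → Γ(X, 𝒪_X)` of a `k`-scheme. -/
def scalars : k →+* X.ringCatSheaf.obj.obj (op ⊤) :=
  f.appTop.hom.comp (Scheme.ΓSpecIso (CommRingCat.of k)).inv.hom

/-- The underlying presheaf (in fact, sheaf) of `k`-modules of an `𝒪_X`-module. -/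
def toPresheafModuleCat : X.Modules ⥤ TopCat.Presheaf (ModuleCat.{u} k) X :=
  Scheme.Modules.toPresheafOfModules X ⋙
    PresheafOfModules.forgetToPresheafModuleCat (op ⊤)
      (Limits.initialOpOfTerminal Limits.isTerminalTop) ⋙
    (Functor.whiskeringRight _ _ _).obj (ModuleCat.restrictScalars (scalars f))

instance : (toPresheafModuleCat f).Additive where
  map_add := rfl

/-- `C^{i,j}_TW(F^•(𝒰))` for a complex `F^•` of `𝒪_X`-modules on a `k`-scheme `X` and a finite
family of open sets `𝒰`, as a presheaf of `k`-modules on `X`. -/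
def twPresheaf {r : ℕ} (U : Fin r → X.Opens) (F : CochainComplex X.Modules ℤ) (i : ℕ) (j : ℤ) :
    TopCat.Presheaf (ModuleCat.{u} k) X :=
  presheafC (cech U (((toPresheafModuleCat f).mapHomologicalComplex _).obj F)) i j

end Schemes

/-- Cohomology `H^ℓ(X, S)` of a sheaf of `k`-modules `S` on a topological space `X`: the sheaf
cohomology of the underlying sheaf of abelian groups. -/
abbrev cohomology {k : Type u} [CommRing k] {X : TopCat.{u}}
    (S : TopCat.Sheaf (ModuleCat.{u} k) X) (ℓ : ℕ) : Type u :=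
  Sheaf.H.{u} ((sheafCompose (Opens.grothendieckTopology X)
    (forget₂ (ModuleCat.{u} k) AddCommGrpCat.{u})).obj S) ℓ

end ThomWhitney

end

universe w

noncomputable section

namespace ThomWhitney

namespace APL

/-! ### Functoriality of forms in maps of vertices -/

section Pullback

variable {k : Type u} [CommRing k]

/-! For fixed degrees, the Thom–Whitney space is the subspace of `∏ A_n^i ⊗ V_n^j` cut out by the
face conditions, and it is a direct summand, naturally in `V`. The reason is that forms on simplices
are extendable: a compatible family on the faces extends to the whole simplex
(`APL.exists_face_eq`), over a field it does so linearly (`APL.exists_linear_filling`), and a linear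
extension can be tensored with any coefficients. Filling one cosimplicial degree after another gives
`retraction`; since the choices concern forms only, it is natural in `V` (`mapC_retraction`).

In the Čech case only the degrees `n < r` are nonzero, so the identity of the Thom–Whitney presheaf
is a finite sum of maps factoring through the presheaves `T_σ : V ↦ A_n^i ⊗ F^j(V ∩ U_σ)`
(`sum_toTensorRestrict_comp_ofTensorRestrict`). Both the sheaf property and the vanishing of
cohomology pass from the `T_σ` to such a retract.

`T_σ` is a sheaf because `X` is noetherian: coordinates in a basis of `A_n^i` are glued separately,
and finite subcovers keep the result finitely supported. For the vanishing, cohomology of open sets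
is expressed as `Ext` from free abelian sheaves, which gives Mayer–Vietoris sequences. On affine
opens, local triviality of classes and the splitting of sections over two basic opens suffice
(`IsAffineAcyclic.openH_eq_zero`). To reach all of `X`, the affines of the cover are added one by
one to `U_σ`; as sections of `T_σ` over `V` and over `V ∩ U_σ` agree, no new class arises
(`IsAffineAcyclic.openH_sup_eq_zero`). -/

lemma sum_dt_mul_sum_dt_self {n : ℕ} (s : Finset (Fin (n + 1))) :
    ((∑ a ∈ s, dt a) * ∑ a ∈ s, dt a : APL k n) = 0 := by
  induction s using Finset.induction_on with
  | empty => simp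
  | insert a s ha ih =>
    have h : (dt a * ∑ b ∈ s, dt b : APL k n) = -((∑ b ∈ s, dt b) * dt a) := by
      rw [Finset.mul_sum, Finset.sum_mul, ← Finset.sum_neg_distrib]
      exact Finset.sum_congr rfl fun b _ ↦ dt_anticomm a b
    rw [Finset.sum_insert ha, mul_add, add_mul, add_mul, dt_sq, ih, h]
    simp

/-- The pullback of forms along the affine map of simplices given by a map of vertices. -/
def pullback {m n : ℕ} (θ : Fin (m + 1) → Fin (n + 1)) : APL k n →ₐ[k] APL k m :=
  RingQuot.liftAlgHom k ⟨FreeAlgebra.lift k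
    (Sum.elim (fun a ↦ ∑ b with θ b = a, t b) (fun a ↦ ∑ b with θ b = a, dt b)), by
    intro x y h
    induction h with
    | t_comm a b =>
      simp only [map_mul, FreeAlgebra.lift_ι_apply, Sum.elim_inl, Finset.sum_mul_sum]
      rw [Finset.sum_comm]
      simp only [t_comm]
    | t_dt_comm a b =>
      simp only [map_mul, FreeAlgebra.lift_ι_apply, Sum.elim_inl, Sum.elim_inr,
        Finset.sum_mul_sum]
      rw [Finset.sum_comm]
      simp only [t_dt_comm]
    | dt_anticomm a b =>
      simp only [map_mul, map_neg, FreeAlgebra.lift_ι_apply, Sum.elim_inr,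
        Finset.sum_mul_sum, ← Finset.sum_neg_distrib]
      rw [Finset.sum_comm]
      simp only [← dt_anticomm]
    -- Anticommutativity alone would only kill twice the square; cancelling cross terms against the
    -- relations `dt_a² = 0` also covers characteristic 2.
    | dt_sq a => simp [sum_dt_mul_sum_dt_self]
    | sum_t => simp [Finset.sum_fiberwise, sum_t]
    | sum_dt => simp [Finset.sum_fiberwise, sum_dt]⟩

lemma pullback_t {m n : ℕ} (θ : Fin (m + 1) → Fin (n + 1)) (a : Fin (n + 1)) :
    pullback θ (t a : APL k n) = ∑ b with θ b = a, t b := by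
  simp only [pullback, t, mk]
  erw [RingQuot.liftAlgHom_mkAlgHom_apply]
  simp

lemma pullback_dt {m n : ℕ} (θ : Fin (m + 1) → Fin (n + 1)) (a : Fin (n + 1)) :
    pullback θ (dt a : APL k n) = ∑ b with θ b = a, dt b := by
  simp only [pullback, dt, mk]
  erw [RingQuot.liftAlgHom_mkAlgHom_apply]
  simp

lemma algHom_ext {n : ℕ} {B : Type*} [Semiring B] [Algebra k B] {φ ψ : APL k n →ₐ[k] B}
    (ht : ∀ a, φ (t a) = ψ (t a)) (hdt : ∀ a, φ (dt a) = ψ (dt a)) : φ = ψ := by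
  refine RingQuot.ringQuot_ext' (s := FormsRel k n) (S := k) φ ψ (FreeAlgebra.hom_ext (funext ?_))
  rintro (a | a)
  · exact ht a
  · exact hdt a

lemma pullback_comp {l m n : ℕ} (η : Fin (l + 1) → Fin (m + 1)) (θ : Fin (m + 1) → Fin (n + 1)) :
    (pullback η).comp (pullback θ) = pullback (k := k) (θ ∘ η) := by
  have key {M : Type u} [AddCommMonoid M] (f : Fin (l + 1) → M) (a : Fin (n + 1)) :
      ∑ b with θ b = a, ∑ c with η c = b, f c = ∑ c with (θ ∘ η) c = a, f c := by
    rw [Finset.sum_comm' (t' := Finset.univ.filter fun c ↦ (θ ∘ η) c = a) (s' := fun c ↦ {η c})]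
    · simp
    · intro x y
      simp only [Finset.mem_filter_univ, Finset.mem_singleton, Function.comp_apply]
      constructor
      · rintro ⟨rfl, rfl⟩; exact ⟨rfl, rfl⟩
      · rintro ⟨rfl, rfl⟩; exact ⟨rfl, rfl⟩
  refine algHom_ext (fun a ↦ ?_) fun a ↦ ?_
  · simp only [AlgHom.comp_apply, pullback_t, map_sum, key]
  · simp only [AlgHom.comp_apply, pullback_dt, map_sum, key]

lemma pullback_id (n : ℕ) : pullback (k := k) (id : Fin (n + 1) → Fin (n + 1)) = AlgHom.id k _ := by
  refine algHom_ext (fun a ↦ ?_) fun a ↦ ?_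
  · simp [pullback_t, Finset.filter_eq']
  · simp [pullback_dt, Finset.filter_eq']

/-- Reduces every simplicial identity between faces and degeneracies to an identity between maps of
finite ordinals. -/
lemma face_eq_pullback {n : ℕ} (l : Fin (n + 2)) :
    face (k := k) l = pullback l.succAbove := by
  refine algHom_ext (fun a ↦ ?_) fun a ↦ ?_
  · rw [face_t, pullback_t]
    cases a using l.succAboveCases with
    | x => simp [Fin.succAbove_ne]
    | p b => simp [Finset.filter_eq']
  · rw [face_dt, pullback_dt]
    cases a using l.succAboveCases with
    | x => simp [Fin.succAbove_ne]
    | p b => simp [Finset.filter_eq']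

lemma pullback_mem_deg {m n i : ℕ} (θ : Fin (m + 1) → Fin (n + 1)) {x : APL k n}
    (hx : x ∈ deg k n i) : pullback θ x ∈ deg k m i := by
  suffices (deg k n i).map (pullback θ).toLinearMap ≤ deg k m i from
    this (Submodule.mem_map_of_mem hx)
  unfold deg
  rw [Submodule.map_mul, Submodule.map_pow]
  refine mul_le_mul' ?_ (pow_le_pow_left' ?_ i)
  · rw [← Subalgebra.map_toSubmodule]
    refine Subalgebra.toSubmodule.monotone ?_
    rw [AlgHom.map_adjoin]
    refine Algebra.adjoin_le ?_
    rintro _ ⟨_, ⟨a, rfl⟩, rfl⟩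
    rw [pullback_t]
    exact sum_mem fun b _ ↦ Algebra.subset_adjoin (Set.mem_range_self b)
  · rw [Submodule.map_span, Submodule.span_le]
    rintro _ ⟨_, ⟨a, rfl⟩, rfl⟩
    rw [AlgHom.toLinearMap_apply, pullback_dt]
    exact sum_mem fun b _ ↦ Submodule.subset_span (Set.mem_range_self b)

lemma t_mul_mem_deg {n i : ℕ} (a : Fin (n + 1)) {x : APL k n} (hx : x ∈ deg k n i) :
    t a * x ∈ deg k n i := by
  have ha : (t a : APL k n) ∈ Subalgebra.toSubmodule (Algebra.adjoin k (Set.range t)) :=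
    Algebra.subset_adjoin (Set.mem_range_self a)
  have h := Submodule.mul_mem_mul ha hx
  unfold deg at h ⊢
  rwa [← mul_assoc, Subalgebra.isIdempotentElem_toSubmodule _] at h

end Pullback

/-! ### Extending forms from the boundary of a simplex -/

section Filling

variable {k : Type u} [CommRing k]

/-- A form vanishes on the face opposite to the vertex `a` if its pullback along every map of
simplices with image in that face is zero. -/
def VanishesOpposite {n : ℕ} (a : Fin (n + 1)) (y : APL k n) : Prop :=
  ∀ (m : ℕ) (θ : Fin (m + 1) → Fin (n + 1)), (∀ b, θ b ≠ a) → pullback θ y = 0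

lemma VanishesOpposite.of_face {n : ℕ} {a : Fin (n + 2)} {y : APL k (n + 1)}
    (h : face a y = 0) : VanishesOpposite a y := by
  intro m θ hθ
  choose η hη using fun b ↦ Fin.exists_succAbove_eq (hθ b)
  obtain rfl : a.succAbove ∘ η = θ := funext hη
  rw [← pullback_comp, AlgHom.comp_apply, ← face_eq_pullback, h, map_zero]

lemma VanishesOpposite.mul_left {n : ℕ} {a : Fin (n + 1)} {y : APL k n}
    (h : VanishesOpposite a y) (x : APL k n) : VanishesOpposite a (x * y) := by
  intro m θ hθ
  rw [map_mul, h m θ hθ, mul_zero]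

/-- The degeneracy maps. -/
abbrev degeneracy {n : ℕ} (j : Fin (n + 1)) : APL k n →ₐ[k] APL k (n + 1) := pullback j.predAbove

lemma coe_predAbove {n : ℕ} (j : Fin (n + 1)) (c : Fin (n + 2)) :
    (j.predAbove c : ℕ) = if (j : ℕ) < c then (c : ℕ) - 1 else c := by
  simp only [Fin.predAbove, Fin.lt_def, Fin.val_castSucc]
  split_ifs <;> rfl

lemma face_degeneracy_castSucc {n : ℕ} (j : Fin (n + 1)) (y : APL k n) :
    face j.castSucc (degeneracy j y) = y := by
  rw [face_eq_pullback, ← AlgHom.comp_apply, pullback_comp,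
    show j.predAbove ∘ j.castSucc.succAbove = id from funext fun b ↦ by simp, pullback_id]
  rfl

lemma face_degeneracy_succ {n : ℕ} (j : Fin (n + 1)) (y : APL k n) :
    face j.succ (degeneracy j y) = y := by
  have h : j.predAbove ∘ j.succ.succAbove = id := by
    funext b
    have h' : (j.succ.succAbove b : ℕ) = if (b : ℕ) < j + 1 then (b : ℕ) else b + 1 := by
      simp only [Fin.succAbove, Fin.lt_def, Fin.val_castSucc, Fin.val_succ]
      split_ifs <;> rfl
    rw [Fin.ext_iff, Function.comp_apply, coe_predAbove, h', id]
    split_ifs <;> omega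
  rw [face_eq_pullback, ← AlgHom.comp_apply, pullback_comp, h, pullback_id]
  rfl

/-- The degeneracy identifies only the vertices `j.castSucc` and `j.succ`, so for any other `l` the
face opposite to `l` is mapped into the face opposite to `j.predAbove l`. -/
lemma face_degeneracy_of_vanishesOpposite {n : ℕ} {j : Fin (n + 1)} {l : Fin (n + 2)}
    (hl : l ≠ j.castSucc) (hl' : l ≠ j.succ) {y : APL k n}
    (hy : VanishesOpposite (j.predAbove l) y) : face l (degeneracy j y) = 0 := by
  rw [face_eq_pullback, ← AlgHom.comp_apply, pullback_comp]
  refine hy _ _ fun b hb ↦ Fin.succAbove_ne l b ?_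
  have hb' := congr_arg Fin.val hb
  simp only [Function.comp_apply, coe_predAbove] at hb'
  simp only [ne_eq, Fin.ext_iff, Fin.val_castSucc, Fin.val_succ] at hl hl' ⊢
  split_ifs at hb' <;> omega

/-- The degenerate form of `y` has the two nonzero faces `j.castSucc` and `j.succ`, both equal to
`y`. Multiplying by `t j.castSucc` kills the first and turns the second into `t j * y`. -/
lemma exists_face_eq_t_mul {n i : ℕ} {y : APL k n} (hy : y ∈ deg k n i)
    (hy' : ∀ a, VanishesOpposite a y) (j : Fin (n + 1)) :
    ∃ x ∈ deg k (n + 1) i, face j.succ x = t j * y ∧ ∀ m, m ≠ j.succ → face m x = 0 := by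
  refine ⟨t j.castSucc * degeneracy j y, t_mul_mem_deg _ (pullback_mem_deg _ hy), ?_, ?_⟩
  · rw [map_mul, face_t, face_degeneracy_succ]
    congr 1
    have h := Fin.insertNth_apply_succAbove (α := fun _ ↦ APL k n) j.succ 0 t j
    rwa [Fin.succAbove_of_castSucc_lt _ _ j.castSucc_lt_succ] at h
  · intro m hm
    rw [map_mul]
    by_cases hm' : m = j.castSucc
    · rw [hm', face_t, Fin.insertNth_apply_same, zero_mul]
    · rw [face_degeneracy_of_vanishesOpposite hm' hm (hy' _), mul_zero]

/-- Subtracting `x` from the degenerate form of `y` moves the single nonzero face from `j.castSucc`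
to `j.succ`; repeating this reaches the last face. -/
lemma exists_face_last_eq_of_exists_face_eq {n i : ℕ} {y : APL k n} (hy : y ∈ deg k n i)
    (hy' : ∀ a, VanishesOpposite a y) (l : Fin (n + 2))
    (h : ∃ x ∈ deg k (n + 1) i, face l x = y ∧ ∀ m, m ≠ l → face m x = 0) :
    ∃ x ∈ deg k (n + 1) i, face (Fin.last _) x = y ∧ ∀ m, m ≠ Fin.last _ → face m x = 0 := by
  induction l using Fin.reverseInduction with
  | last => exact h
  | cast j ih =>
    obtain ⟨x, hx, hx', hx''⟩ := h
    refine ih ⟨degeneracy j y - x, sub_mem (pullback_mem_deg _ hy) hx, ?_, ?_⟩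
    · rw [map_sub, face_degeneracy_succ, hx'' _ (by simp [Fin.ext_iff]), sub_zero]
    · intro m hm
      rw [map_sub]
      by_cases hm' : m = j.castSucc
      · rw [hm', face_degeneracy_castSucc, hx', sub_self]
      · rw [face_degeneracy_of_vanishesOpposite hm' hm (hy' _), hx'' _ hm', sub_zero]

/-- Partition of unity: `y = ∑ t j * y`, and each summand has a filling concentrated on one face,
which can be moved to the last one. -/
lemma exists_face_last_eq {n i : ℕ} {y : APL k n} (hy : y ∈ deg k n i)
    (hy' : ∀ a, VanishesOpposite a y) :
    ∃ x ∈ deg k (n + 1) i, face (Fin.last _) x = y ∧ ∀ m, m ≠ Fin.last _ → face m x = 0 := by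
  choose x hx hx' hx'' using fun j ↦ exists_face_last_eq_of_exists_face_eq
    (t_mul_mem_deg j hy) (fun a ↦ (hy' a).mul_left _) _ (exists_face_eq_t_mul hy hy' j)
  refine ⟨∑ j, x j, sum_mem fun j _ ↦ hx j, ?_, fun m hm ↦ ?_⟩
  · rw [map_sum, Finset.sum_congr rfl fun j _ ↦ hx' j, ← Finset.sum_mul, sum_t, one_mul]
  · rw [map_sum, Finset.sum_congr rfl fun j _ ↦ hx'' j m hm, Finset.sum_const_zero]

/-- Nothing is asked of the faces after `l`, so a degeneracy suffices unless `l` is last; only in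
that case is the partition of unity needed. -/
lemma exists_face_eq_of_vanishesOpposite {n i : ℕ} (l : Fin (n + 2)) {y : APL k n}
    (hy : y ∈ deg k n i) (hy' : ∀ a : Fin (n + 1), a.castSucc < l → VanishesOpposite a y) :
    ∃ x ∈ deg k (n + 1) i, face l x = y ∧ ∀ m < l, face m x = 0 := by
  cases l using Fin.lastCases with
  | last =>
    obtain ⟨x, hx, h, h'⟩ := exists_face_last_eq hy fun a ↦ hy' a a.castSucc_lt_last
    exact ⟨x, hx, h, fun m hm ↦ h' m hm.ne⟩
  | cast j =>
    refine ⟨degeneracy j y, pullback_mem_deg _ hy, face_degeneracy_castSucc j y, fun m hm ↦ ?_⟩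
    refine face_degeneracy_of_vanishesOpposite hm.ne (hm.trans j.castSucc_lt_succ).ne (hy' _ ?_)
    rw [Fin.predAbove_of_le_castSucc _ _ hm.le]
    simpa using hm

lemma succ_succAbove_succAbove {n : ℕ} {a b : Fin (n + 2)} (h : a ≤ b) (c : Fin (n + 1)) :
    b.succ.succAbove (a.succAbove c) = a.castSucc.succAbove (b.succAbove c) := by
  simp only [Fin.succAbove, Fin.ext_iff, Fin.lt_def, Fin.le_def] at *
  split_ifs <;> simp at * <;> omega

lemma face_face {n : ℕ} {a b : Fin (n + 2)} (h : a ≤ b) (x : APL k (n + 2)) :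
    face a (face b.succ x) = face b (face a.castSucc x) := by
  simp only [face_eq_pullback, ← AlgHom.comp_apply, pullback_comp]
  congr 2
  exact funext (succ_succAbove_succAbove h)

/-- The compatibility condition satisfied by the faces of a form. -/
def Compatible {M : ℕ → Type*} (d : ∀ {n : ℕ}, Fin (n + 2) → M (n + 1) → M n) :
    ∀ {n : ℕ}, (Fin (n + 2) → M n) → Prop
  | 0, _ => True
  | _ + 1, y => ∀ a b, a ≤ b → d a (y b.succ) = d b (y a.castSucc)

/-- A compatible family of forms on the faces of a simplex extends to the simplex. -/
theorem exists_face_eq {n i : ℕ} (y : Fin (n + 2) → APL k n) (hy : ∀ l, y l ∈ deg k n i)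
    (h : Compatible (M := APL k) (fun l ↦ face l) y) :
    ∃ x ∈ deg k (n + 1) i, ∀ l, face l x = y l := by
  suffices ∀ N : ℕ, ∃ x ∈ deg k (n + 1) i, ∀ l : Fin (n + 2), l < N → face l x = y l by
    obtain ⟨x, hx, hx'⟩ := this (n + 2)
    exact ⟨x, hx, fun l ↦ hx' l l.2⟩
  -- The faces are corrected in increasing order; each correction vanishes on the faces already
  -- treated.
  intro N
  induction N with
  | zero => exact ⟨0, zero_mem _, by simp⟩
  | succ N ih =>
    obtain ⟨x, hx, hx'⟩ := ih
    by_cases hN : N < n + 2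
    swap
    · exact ⟨x, hx, fun l hl ↦ hx' l (by omega)⟩
    let l : Fin (n + 2) := ⟨N, hN⟩
    obtain ⟨z, hz, hz', hz''⟩ := exists_face_eq_of_vanishesOpposite l (y := y l - face l x)
      (sub_mem (hy l) (map_face_deg_le k l i (Submodule.mem_map_of_mem hx))) (by
        intro a ha
        cases n with
        -- The only vertex of a 0-simplex cannot be avoided, so the vanishing condition is vacuous.
        | zero =>
          intro m θ hθ
          exact absurd (Subsingleton.elim (α := Fin 1) _ _) (hθ 0)
        | succ n =>
          apply VanishesOpposite.of_face
          obtain ⟨b, hb⟩ : ∃ b, l = Fin.succ b := Fin.exists_succ_eq.2 (Fin.ne_zero_of_lt ha) |>.imp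
            fun _ h ↦ h.symm
          have hab : a ≤ b := by
            rw [hb] at ha
            exact Fin.castSucc_lt_succ_iff.1 ha
          have hy' : face a (y b.succ) = face b (y a.castSucc) := h a b hab
          rw [map_sub, hb, hy', face_face hab, hx' _ ha, sub_self])
    refine ⟨x + z, add_mem hx hz, fun m hm ↦ ?_⟩
    rw [map_add]
    rcases Nat.lt_succ_iff_lt_or_eq.1 hm with hm | hm
    · rw [hx' m hm, hz'' m hm, add_zero]
    · obtain rfl : m = l := Fin.ext hm
      rw [hz']
      abel

end Filling

/-! ### Linear choice of extensions over a field -/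

section LinearFilling

variable (k : Type u) [Field k]

/-- A generalized inverse: split `d` onto its range, then extend the splitting to all of `W`. -/
lemma exists_linearMap_apply_eq {K V W : Type*} [Field K] [AddCommGroup V] [Module K V]
    [AddCommGroup W] [Module K W] (d : V →ₗ[K] W) :
    ∃ e : W →ₗ[K] V, ∀ x, d (e (d x)) = d x := by
  obtain ⟨g, hg⟩ := d.rangeRestrict.exists_rightInverse_of_surjective d.range_rangeRestrict
  obtain ⟨e, he⟩ := g.exists_extend
  refine ⟨e, fun x ↦ ?_⟩
  have h1 : e (d x) = g (d.rangeRestrict x) := LinearMap.congr_fun he (d.rangeRestrict x)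
  rw [h1]
  exact congr_arg Subtype.val (LinearMap.congr_fun hg (d.rangeRestrict x))

/-- Over a field, compatible families of forms on the faces can be extended linearly. -/
theorem exists_linear_filling (n i : ℕ) :
    ∃ e : Fin (n + 2) → deg k n i →ₗ[k] deg k (n + 1) i,
      ∀ y : Fin (n + 2) → deg k n i,
        Compatible (M := fun n ↦ deg k n i) (fun l ↦ faceDeg k l i) y →
        ∀ m, faceDeg k m i (∑ l, e l (y l)) = y m := by
  let d : deg k (n + 1) i →ₗ[k] Fin (n + 2) → deg k n i := LinearMap.pi fun l ↦ faceDeg k l i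
  obtain ⟨e, he⟩ := exists_linearMap_apply_eq d
  refine ⟨fun l ↦ e ∘ₗ LinearMap.single k (fun _ ↦ deg k n i) l, fun y hy m ↦ ?_⟩
  -- By the extension theorem a compatible family lies in the range of the boundary map `d`, where
  -- the generalized inverse is a true section.
  obtain ⟨x, rfl⟩ : y ∈ LinearMap.range d := by
    obtain ⟨x, hx, hx'⟩ := exists_face_eq (fun l ↦ (y l : APL k n)) (fun l ↦ (y l).2) (by
      cases n with
      | zero => trivial
      | succ n => exact fun a b hab ↦ congr_arg Subtype.val (hy a b hab))
    exact ⟨⟨x, hx⟩, funext fun l ↦ Subtype.ext (hx' l)⟩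
  have h1 : ∑ l, (e ∘ₗ LinearMap.single k (fun _ ↦ deg k n i) l) (d x l) = e (d x) := by
    simp only [LinearMap.comp_apply, ← map_sum]
    exact congr_arg e (Finset.univ_sum_single (d x))
  rw [h1]
  exact congr_fun (he x) m

end LinearFilling
end APL

/-! ### Extensions with coefficients -/

section TensorFilling

/-- Elements of a tensor product of vector spaces are separated by contractions. -/
lemma tensor_ext_dual {k A M : Type*} [Field k] [AddCommGroup A] [Module k A] [AddCommGroup M]
    [Module k M] {z w : A ⊗[k] M}
    (h : ∀ φ : M →ₗ[k] k, TensorProduct.rid k A (φ.lTensor A z) =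
      TensorProduct.rid k A (φ.lTensor A w)) : z = w := by
  classical
  let b := Module.Basis.ofVectorSpace k M
  apply (TensorProduct.equivFinsuppOfBasisRight (M := A) b).injective
  ext i
  have key (z : A ⊗[k] M) : TensorProduct.equivFinsuppOfBasisRight (M := A) b z i =
      TensorProduct.rid k A ((b.coord i).lTensor A z) := by
    induction z with
    | zero => simp
    | tmul x y => simp
    | add x y hx hy => simp [hx, hy]
  rw [key, key, h]

lemma lTensor_rTensor_comm {k A B M N : Type*} [CommRing k] [AddCommGroup A] [Module k A]
    [AddCommGroup B] [Module k B] [AddCommGroup M] [Module k M] [AddCommGroup N] [Module k N]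
    (f : A →ₗ[k] B) (g : M →ₗ[k] N) (z : A ⊗[k] M) :
    g.lTensor B (f.rTensor M z) = f.rTensor N (g.lTensor A z) := by
  rw [← LinearMap.comp_apply, ← LinearMap.comp_apply, LinearMap.rTensor_comp_lTensor,
    LinearMap.lTensor_comp_rTensor]

variable (k : Type u) [Field k]

namespace APL

/-- Linear maps extending compatible families of forms on the faces of a simplex. -/
def filling (n i : ℕ) : Fin (n + 2) → deg k n i →ₗ[k] deg k (n + 1) i :=
  (exists_linear_filling k n i).choose

lemma faceDeg_sum_filling {n i : ℕ} (y : Fin (n + 2) → deg k n i)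
    (hy : Compatible (M := fun n ↦ deg k n i) (fun l ↦ faceDeg k l i) y) (m : Fin (n + 2)) :
    faceDeg k m i (∑ l, filling k n i l (y l)) = y m :=
  (exists_linear_filling k n i).choose_spec y hy m

lemma compatible_faceDeg {n i : ℕ} (x : deg k (n + 1) i) :
    Compatible (M := fun n ↦ deg k n i) (fun l ↦ faceDeg k l i) (fun l ↦ faceDeg k l i x) := by
  cases n with
  | zero => trivial
  | succ n => exact fun a b hab ↦ Subtype.ext (face_face hab x.1)

/-- Contracting with linear forms on `M` commutes with all maps between the form factors, which
reduces the claim to scalar coefficients. -/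
lemma rTensor_faceDeg_sum_filling {n i : ℕ} {M : Type*} [AddCommGroup M] [Module k M]
    (y : Fin (n + 2) → deg k n i ⊗[k] M)
    (hy : Compatible (M := fun n ↦ deg k n i ⊗[k] M) (fun l ↦ (faceDeg k l i).rTensor M) y)
    (m : Fin (n + 2)) :
    (faceDeg k m i).rTensor M (∑ l, (filling k n i l).rTensor M (y l)) = y m := by
  have comm {n m : ℕ} (f : deg k n i →ₗ[k] deg k m i) (φ : M →ₗ[k] k) (z : deg k n i ⊗[k] M) :
      TensorProduct.rid k _ (φ.lTensor _ (f.rTensor M z)) =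
        f (TensorProduct.rid k _ (φ.lTensor _ z)) := by
    induction z with
    | zero => simp
    | tmul x y => simp
    | add x y hx hy => simp [hx, hy]
  refine tensor_ext_dual fun φ ↦ ?_
  rw [comm]
  simp only [map_sum, comm]
  rw [← map_sum, faceDeg_sum_filling k (fun l ↦ TensorProduct.rid k _ (φ.lTensor _ (y l)))]
  cases n with
  | zero => trivial
  | succ n =>
    intro a b hab
    have h : (faceDeg k a i).rTensor M (y b.succ) = (faceDeg k b i).rTensor M (y a.castSucc) :=
      hy a b hab
    dsimp only
    rw [← comm, ← comm, h]

/-- The projection onto the forms vanishing on all faces. -/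
def bubble (n i : ℕ) : deg k (n + 1) i →ₗ[k] deg k (n + 1) i :=
  LinearMap.id - ∑ l, filling k n i l ∘ₗ faceDeg k l i

lemma faceDeg_bubble {n i : ℕ} (m : Fin (n + 2)) : faceDeg k m i ∘ₗ bubble k n i = 0 := by
  ext1 x
  have h := faceDeg_sum_filling k _ (compatible_faceDeg k x) m
  simp only [bubble, LinearMap.comp_apply, LinearMap.sub_apply, LinearMap.sum_apply,
    LinearMap.id_apply, map_sub, LinearMap.zero_apply] at h ⊢
  rw [h, sub_self]

end APL

end TensorFilling

/-! ### The natural retraction onto the Thom–Whitney space -/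

section Retraction

variable {k : Type u} [Field k]
variable (V : Semicosimplicial (CochainComplex (ModuleCat.{u} k) ℤ)) (i : ℕ) (j : ℤ)

/-- The coface maps in a fixed degree. -/
def cofaceMap {n : ℕ} (l : Fin (n + 2)) : (V.obj (.mk n)).X j →ₗ[k] (V.obj (.mk (n + 1))).X j :=
  ((V.map (coface l)).f j).hom

lemma coface_comp {n : ℕ} {a b : Fin (n + 2)} (h : a ≤ b) :
    coface a ≫ coface b.succ = coface b ≫ coface a.castSucc := by
  ext c : 2
  exact APL.succ_succAbove_succAbove h c

lemma cofaceMap_comp {n : ℕ} {a b : Fin (n + 2)} (h : a ≤ b) :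
    cofaceMap V j b.succ ∘ₗ cofaceMap V j a = cofaceMap V j a.castSucc ∘ₗ cofaceMap V j b := by
  have h := congr((V.map $(coface_comp h)).f j)
  rw [V.map_comp, V.map_comp] at h
  exact congr(ModuleCat.Hom.hom $h)

/-- The components of the retraction of the product of all `(A_PL)_n^i ⊗ V_n^j` onto
`C^{i,j}_TW(V)`. -/
def retractionComp : ∀ n : ℕ, (∀ n : ℕ, APL.deg k n i ⊗[k] (V.obj (.mk n)).X j) →ₗ[k]
    APL.deg k n i ⊗[k] (V.obj (.mk n)).X j
  | 0 => LinearMap.proj 0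
  -- The given element contributes only its part with zero boundary; the boundary itself is
  -- prescribed by the cofaces of the component already built.
  | n + 1 => (APL.bubble k n i).rTensor _ ∘ₗ LinearMap.proj (n + 1) +
      (∑ l, TensorProduct.map (APL.filling k n i l) (cofaceMap V j l)) ∘ₗ retractionComp n

variable {V i j}

lemma mem_C_iff {x : ∀ n : ℕ, APL.deg k n i ⊗[k] (V.obj (.mk n)).X j} :
    x ∈ C V i j ↔ ∀ (n : ℕ) (l : Fin (n + 2)),
      (APL.faceDeg k l i).rTensor _ (x (n + 1)) = (cofaceMap V j l).lTensor _ (x n) :=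
  Iff.rfl

/-- The face condition in one degree, with the cosimplicial identities, makes the boundary data for
the next degree fillable; this drives the induction in `retractionComp_mem`. -/
lemma compatible_cofaceMap {n : ℕ} {x : APL.deg k (n + 1) i ⊗[k] (V.obj (.mk (n + 1))).X j}
    {y : APL.deg k n i ⊗[k] (V.obj (.mk n)).X j}
    (h : ∀ l, (APL.faceDeg k l i).rTensor _ x = (cofaceMap V j l).lTensor _ y) :
    APL.Compatible (M := fun n' ↦ APL.deg k n' i ⊗[k] (V.obj (.mk (n + 2))).X j)
      (fun l ↦ (APL.faceDeg k l i).rTensor _) (fun l ↦ (cofaceMap V j l).lTensor _ x) := by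
  intro a b hab
  have comm (l l') : (APL.faceDeg k l i).rTensor _ ((cofaceMap V j l').lTensor _ x) =
      (cofaceMap V j l').lTensor _ ((APL.faceDeg k l i).rTensor _ x) :=
    (lTensor_rTensor_comm _ _ _).symm
  dsimp only
  rw [comm, comm, h, h, ← LinearMap.comp_apply, ← LinearMap.comp_apply,
    ← LinearMap.lTensor_comp, ← LinearMap.lTensor_comp, cofaceMap_comp V j hab]

lemma retractionComp_succ (n : ℕ) (a : ∀ n : ℕ, APL.deg k n i ⊗[k] (V.obj (.mk n)).X j) :
    retractionComp V i j (n + 1) a = (APL.bubble k n i).rTensor _ (a (n + 1)) +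
      ∑ l, (APL.filling k n i l).rTensor _
        ((cofaceMap V j l).lTensor _ (retractionComp V i j n a)) := by
  simp only [retractionComp, LinearMap.add_apply, LinearMap.comp_apply, LinearMap.proj_apply,
    LinearMap.sum_apply]
  congr 1
  refine Finset.sum_congr rfl fun l _ ↦ ?_
  rw [← LinearMap.comp_apply, ← LinearMap.comp_apply (LinearMap.rTensor _ _),
    LinearMap.rTensor_comp_lTensor]
  rfl

lemma rTensor_faceDeg_retractionComp {n : ℕ}
    (a : ∀ n : ℕ, APL.deg k n i ⊗[k] (V.obj (.mk n)).X j)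
    (h : APL.Compatible (M := fun n' ↦ APL.deg k n' i ⊗[k] (V.obj (.mk (n + 1))).X j)
      (fun l ↦ (APL.faceDeg k l i).rTensor _)
      (fun l ↦ (cofaceMap V j l).lTensor _ (retractionComp V i j n a))) (m : Fin (n + 2)) :
    (APL.faceDeg k m i).rTensor _ (retractionComp V i j (n + 1) a) =
      (cofaceMap V j m).lTensor _ (retractionComp V i j n a) := by
  rw [retractionComp_succ, map_add, ← LinearMap.comp_apply, ← LinearMap.rTensor_comp,
    APL.faceDeg_bubble, LinearMap.rTensor_zero, LinearMap.zero_apply, zero_add]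
  exact APL.rTensor_faceDeg_sum_filling k _ h m

lemma retractionComp_mem (a : ∀ n : ℕ, APL.deg k n i ⊗[k] (V.obj (.mk n)).X j) :
    (fun n ↦ retractionComp V i j n a) ∈ C V i j := by
  rw [mem_C_iff]
  intro n
  induction n with
  | zero => exact rTensor_faceDeg_retractionComp a trivial
  | succ n ih => exact rTensor_faceDeg_retractionComp a (compatible_cofaceMap ih)

/-- For a compatible `a` the cofaces of `a n` are the faces of `a (n + 1)`, and the bubble
projection plus the filling of the faces is the identity. -/
lemma retractionComp_of_mem {a : ∀ n : ℕ, APL.deg k n i ⊗[k] (V.obj (.mk n)).X j}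
    (ha : a ∈ C V i j) (n : ℕ) : retractionComp V i j n a = a n := by
  induction n with
  | zero => rfl
  | succ n ih =>
    rw [retractionComp_succ, ih]
    simp only [← mem_C_iff.1 ha n, ← LinearMap.comp_apply, ← LinearMap.rTensor_comp]
    rw [← LinearMap.sum_apply, ← LinearMap.add_apply]
    have h : (APL.bubble k n i).rTensor ((V.obj (.mk (n + 1))).X j) +
        ∑ l, (APL.filling k n i l ∘ₗ APL.faceDeg k l i).rTensor _ = LinearMap.id := by
      have h' : APL.bubble k n i + ∑ l, APL.filling k n i l ∘ₗ APL.faceDeg k l i = LinearMap.id :=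
        LinearMap.ext fun x ↦ by
          simp [APL.bubble]
      rw [← LinearMap.rTensor_id, ← h']
      simp only [← LinearMap.coe_rTensorHom, map_add, map_sum]
    rw [h, LinearMap.id_apply]

variable (V i j) in
/-- The retraction of the product of all `(A_PL)_n^i ⊗ V_n^j` onto `C^{i,j}_TW(V)`. -/
def retraction : (∀ n : ℕ, APL.deg k n i ⊗[k] (V.obj (.mk n)).X j) →ₗ[k] C V i j :=
  (LinearMap.pi (retractionComp V i j)).codRestrict _ retractionComp_mem

lemma retraction_coe (x : C V i j) : retraction V i j x.1 = x :=
  Subtype.ext (funext fun n ↦ retractionComp_of_mem x.2 n)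

/-- `bubble` and `filling` act on the form factor only, so they commute with every map of
coefficients. -/
lemma mapC_retraction {W : Semicosimplicial (CochainComplex (ModuleCat.{u} k) ℤ)} (φ : V ⟶ W)
    (a : ∀ n : ℕ, APL.deg k n i ⊗[k] (V.obj (.mk n)).X j) :
    mapC φ i j (retraction V i j a) =
      retraction W i j fun n ↦ ((φ.app (.mk n)).f j).hom.lTensor _ (a n) := by
  refine Subtype.ext (funext fun n ↦ ?_)
  change ((φ.app (.mk n)).f j).hom.lTensor _ (retractionComp V i j n a) =
    retractionComp W i j n fun n ↦ ((φ.app (.mk n)).f j).hom.lTensor _ (a n)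
  induction n with
  | zero => rfl
  | succ n ih =>
    have nat (l : Fin (n + 2)) : ((φ.app (.mk (n + 1))).f j).hom ∘ₗ cofaceMap V j l =
        cofaceMap W j l ∘ₗ ((φ.app (.mk n)).f j).hom :=
      congr(ModuleCat.Hom.hom $(congr(($(φ.naturality (coface l))).f j)))
    rw [retractionComp_succ, retractionComp_succ, ← ih, map_add, map_sum]
    congr 1
    · exact lTensor_rTensor_comm _ _ _
    · refine Finset.sum_congr rfl fun l _ ↦ ?_
      have h (z) : (cofaceMap W j l).lTensor (APL.deg k n i)
          (((φ.app (.mk n)).f j).hom.lTensor _ z) =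
            ((φ.app (.mk (n + 1))).f j).hom.lTensor _ ((cofaceMap V j l).lTensor _ z) := by
        rw [← LinearMap.lTensor_comp_apply, ← LinearMap.lTensor_comp_apply, nat]
      rw [h]
      exact lTensor_rTensor_comm _ _ _

end Retraction

/-! ### Decomposition of the Thom–Whitney presheaf -/

section TensorRestrict

variable {k : Type u} [CommRing k] {X : TopCat.{u}}

/-- The presheaf `V ↦ W ⊗ P(V ∩ U)`. -/
def tensorRestrict (W : Type u) [AddCommGroup W] [Module k W]
    (P : TopCat.Presheaf (ModuleCat.{u} k) X) (U : Opens X) :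
    TopCat.Presheaf (ModuleCat.{u} k) X where
  obj V := ModuleCat.of k (W ⊗[k] P.obj (op (V.unop ⊓ U)))
  map {V V'} g := ModuleCat.ofHom
    ((P.map (homOfLE (inf_le_inf_right U g.unop.le)).op).hom.lTensor W)
  map_id V := by
    refine ModuleCat.hom_ext ?_
    have h : P.map (homOfLE (inf_le_inf_right U (𝟙 V : V ⟶ V).unop.le)).op = 𝟙 _ := P.map_id _
    rw [ModuleCat.hom_ofHom, h]
    exact LinearMap.lTensor_id _ _
  map_comp {V V' V''} g h := by
    refine ModuleCat.hom_ext ?_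
    have h : P.map (homOfLE (inf_le_inf_right U (g ≫ h).unop.le)).op =
      P.map (homOfLE (inf_le_inf_right U g.unop.le)).op ≫
        P.map (homOfLE (inf_le_inf_right U h.unop.le)).op := P.map_comp _ _
    rw [ModuleCat.hom_ofHom, h]
    exact LinearMap.lTensor_comp _ _ _

end TensorRestrict

section Retract

variable {k : Type u} [Field k] {X : TopCat.{u}} {r : ℕ} (U : Fin r → Opens X)
  (F : CochainComplex (TopCat.Presheaf (ModuleCat.{u} k) X) ℤ) (i : ℕ) (j : ℤ)

/-- The value at an open set of the terms of the Čech semicosimplicial complex. -/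
abbrev cechSections (V : (Opens X)ᵒᵖ) (n : ℕ) : ModuleCat.{u} k :=
  (((sections (cech U F)).obj V).obj (.mk n)).X j

/-- The projection of a Čech term to one of its factors. -/
def cechProj (V : (Opens X)ᵒᵖ) {n : ℕ} (σ : Fin (n + 1) ↪o Fin r) :
    cechSections U F j V n →ₗ[k] (F.X j).obj (op (V.unop ⊓ inter U σ)) :=
  LinearMap.proj (φ := fun σ : Fin (n + 1) ↪o Fin r ↦ (F.X j).obj (op (V.unop ⊓ inter U σ))) σ

/-- The inclusion of one of its factors into a Čech term. -/
def cechSingle (V : (Opens X)ᵒᵖ) {n : ℕ} (σ : Fin (n + 1) ↪o Fin r) :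
    (F.X j).obj (op (V.unop ⊓ inter U σ)) →ₗ[k] cechSections U F j V n :=
  LinearMap.single k (fun σ : Fin (n + 1) ↪o Fin r ↦ (F.X j).obj (op (V.unop ⊓ inter U σ))) σ

/-- The restriction maps of a Čech term. -/
abbrev cechRestriction {V V' : (Opens X)ᵒᵖ} (g : V ⟶ V') (n : ℕ) :
    cechSections U F j V n →ₗ[k] cechSections U F j V' n :=
  ((((sections (cech U F)).map g).app (.mk n)).f j).hom

lemma cechProj_comp_cechRestriction {V V' : (Opens X)ᵒᵖ} (g : V ⟶ V') {n : ℕ}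
    (σ : Fin (n + 1) ↪o Fin r) :
    cechProj U F j V' σ ∘ₗ cechRestriction U F j g n =
      ((F.X j).map (homOfLE (inf_le_inf_right (inter U σ) g.unop.le)).op).hom ∘ₗ
        cechProj U F j V σ :=
  rfl

lemma cechRestriction_comp_cechSingle {V V' : (Opens X)ᵒᵖ} (g : V ⟶ V') {n : ℕ}
    (σ : Fin (n + 1) ↪o Fin r) :
    cechRestriction U F j g n ∘ₗ cechSingle U F j V σ = cechSingle U F j V' σ ∘ₗ
      ((F.X j).map (homOfLE (inf_le_inf_right (inter U σ) g.unop.le)).op).hom := by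
  refine LinearMap.ext fun x ↦ funext fun τ ↦ ?_
  change ((F.X j).map (homOfLE (inf_le_inf_right (inter U τ) g.unop.le)).op).hom
    ((Pi.single σ x : ∀ σ : Fin (n + 1) ↪o Fin r, (F.X j).obj (op (V.unop ⊓ inter U σ))) τ) =
    (Pi.single σ (((F.X j).map (homOfLE (inf_le_inf_right (inter U σ) g.unop.le)).op).hom x) :
      ∀ σ : Fin (n + 1) ↪o Fin r, (F.X j).obj (op (V'.unop ⊓ inter U σ))) τ
  by_cases h : τ = σ
  · subst h
    rw [Pi.single_eq_same, Pi.single_eq_same]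
  · rw [Pi.single_eq_of_ne h, Pi.single_eq_of_ne h, map_zero]

lemma sum_cechSingle_comp_cechProj (V : (Opens X)ᵒᵖ) (n : ℕ) :
    ∑ σ : Fin (n + 1) ↪o Fin r, cechSingle U F j V σ ∘ₗ cechProj U F j V σ = LinearMap.id := by
  refine LinearMap.ext fun x ↦ ?_
  rw [LinearMap.sum_apply]
  exact Finset.univ_sum_single
    (M := fun σ : Fin (n + 1) ↪o Fin r ↦ (F.X j).obj (op (V.unop ⊓ inter U σ))) x

lemma subsingleton_cechSections (V : (Opens X)ᵒᵖ) {n : ℕ} (hn : r ≤ n) :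
    Subsingleton (cechSections U F j V n) := by
  have : IsEmpty (Fin (n + 1) ↪o Fin r) := ⟨fun σ ↦ by
    have := Fintype.card_le_of_injective σ σ.injective
    simp only [Fintype.card_fin] at this
    omega⟩
  exact inferInstanceAs (Subsingleton
    (∀ σ : Fin (n + 1) ↪o Fin r, (F.X j).obj (op (V.unop ⊓ inter U σ))))

/-- The projection of the Thom–Whitney presheaf to the presheaf
`V ↦ (A_PL)_n^i ⊗ F^j(V ∩ U_σ)`. -/
def toTensorRestrict (n : ℕ) (σ : Fin (n + 1) ↪o Fin r) :
    presheafC (cech U F) i j ⟶ tensorRestrict (APL.deg k n i) (F.X j) (inter U σ) where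
  app V := ModuleCat.ofHom <| (cechProj U F j V σ).lTensor (APL.deg k n i) ∘ₗ
      LinearMap.proj (φ := fun n ↦ APL.deg k n i ⊗[k] cechSections U F j V n) n ∘ₗ
      Submodule.subtype _
  naturality V V' g := by
    refine ModuleCat.hom_ext (LinearMap.ext fun x ↦ ?_)
    refine (LinearMap.lTensor_comp_apply (APL.deg k n i) (cechProj U F j V' σ)
      (cechRestriction U F j g n) (x.1 n)).symm.trans ?_
    rw [cechProj_comp_cechRestriction, LinearMap.lTensor_comp_apply]
    rfl

/-- The map from the presheaf `V ↦ (A_PL)_n^i ⊗ F^j(V ∩ U_σ)` to the Thom–Whitney presheaf obtained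
from the retraction of a product onto the latter. -/
def ofTensorRestrict (n : ℕ) (σ : Fin (n + 1) ↪o Fin r) :
    tensorRestrict (APL.deg k n i) (F.X j) (inter U σ) ⟶ presheafC (cech U F) i j where
  app V := ModuleCat.ofHom <| retraction ((sections (cech U F)).obj V) i j ∘ₗ
    LinearMap.single k (fun n ↦ APL.deg k n i ⊗[k] cechSections U F j V n) n ∘ₗ
    (cechSingle U F j V σ).lTensor (APL.deg k n i)
  naturality V V' g := by
    refine ModuleCat.hom_ext (LinearMap.ext fun x ↦ ?_)
    change APL.deg k n i ⊗[k] (F.X j).obj (op (V.unop ⊓ inter U σ)) at x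
    refine Eq.trans (b := retraction ((sections (cech U F)).obj V') i j _) ?_
      (mapC_retraction ((sections (cech U F)).map g) _).symm
    refine congr_arg (retraction ((sections (cech U F)).obj V') i j) (funext fun m ↦ ?_)
    change (Pi.single n ((cechSingle U F j V' σ).lTensor (APL.deg k n i)
        (((F.X j).map (homOfLE (inf_le_inf_right (inter U σ) g.unop.le)).op).hom.lTensor
          (APL.deg k n i) x)) :
        ∀ n, APL.deg k n i ⊗[k] cechSections U F j V' n) m =
      (cechRestriction U F j g m).lTensor (APL.deg k m i)
        ((Pi.single n ((cechSingle U F j V σ).lTensor (APL.deg k n i) x) :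
          ∀ n, APL.deg k n i ⊗[k] cechSections U F j V n) m)
    by_cases hm : m = n
    · subst hm
      rw [Pi.single_eq_same, Pi.single_eq_same, ← LinearMap.lTensor_comp_apply,
        ← LinearMap.lTensor_comp_apply, cechRestriction_comp_cechSingle]
    · rw [Pi.single_eq_of_ne hm, Pi.single_eq_of_ne hm, map_zero]

/-- This is the retraction applied to the decomposition of an element into its Čech components.
Finitely many suffice, since there are no strictly increasing tuples of more than `r` indices. -/
lemma sum_toTensorRestrict_comp_ofTensorRestrict :
    ∑ p : Σ n : Fin r, Fin (n.1 + 1) ↪o Fin r,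
      toTensorRestrict U F i j p.1 p.2 ≫ ofTensorRestrict U F i j p.1 p.2 = 𝟙 _ := by
  refine NatTrans.ext (funext fun V ↦ ModuleCat.hom_ext (LinearMap.ext fun x ↦ ?_))
  rw [NatTrans.app_sum, ModuleCat.hom_sum, LinearMap.sum_apply]
  refine Eq.trans ?_ (retraction_coe (V := (sections (cech U F)).obj V) x)
  have h (n : ℕ) : ∑ σ : Fin (n + 1) ↪o Fin r,
      (cechSingle U F j V σ).lTensor (APL.deg k n i)
        ((cechProj U F j V σ).lTensor (APL.deg k n i) (x.1 n)) = x.1 n := by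
    simp only [← LinearMap.lTensor_comp_apply]
    rw [← LinearMap.sum_apply]
    simp only [← LinearMap.coe_lTensorHom, ← map_sum]
    rw [sum_cechSingle_comp_cechProj]
    simp
  refine Eq.trans (b := ∑ p : Σ n : Fin r, Fin (n.1 + 1) ↪o Fin r,
    retraction ((sections (cech U F)).obj V) i j
      (Pi.single (M := fun n ↦ APL.deg k n i ⊗[k] cechSections U F j V n) p.1.1
        ((cechSingle U F j V p.2).lTensor (APL.deg k p.1 i)
        ((cechProj U F j V p.2).lTensor (APL.deg k p.1 i) (x.1 p.1))))) rfl ?_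
  rw [← map_sum]
  refine congr_arg (retraction ((sections (cech U F)).obj V) i j) (funext fun m ↦ ?_)
  have h' (n : ℕ) : ∑ σ : Fin (n + 1) ↪o Fin r,
      Pi.single (M := fun n ↦ APL.deg k n i ⊗[k] cechSections U F j V n) n
        ((cechSingle U F j V σ).lTensor (APL.deg k n i)
          ((cechProj U F j V σ).lTensor (APL.deg k n i) (x.1 n))) = Pi.single n (x.1 n) := by
    conv_rhs => rw [← h n]
    exact (map_sum (AddMonoidHom.single
      (fun n ↦ APL.deg k n i ⊗[k] cechSections U F j V n) n) _ _).symm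
  rw [Finset.univ_sigma_univ.symm, Finset.sum_sigma]
  simp only [h']
  rw [Finset.sum_apply]
  by_cases hm : m < r
  · rw [Finset.sum_eq_single ⟨m, hm⟩]
    · exact Pi.single_eq_same _ _
    · intro n _ hn
      exact Pi.single_eq_of_ne (fun h ↦ hn (Fin.ext h.symm)) _
    · simp
  · have := subsingleton_cechSections U F j V (not_lt.1 hm)
    have h0 (z : APL.deg k m i ⊗[k] cechSections U F j V m) : z = 0 := by
      induction z with
      | zero => rfl
      | tmul a b => rw [Subsingleton.elim b 0, TensorProduct.tmul_zero]
      | add a b ha hb => rw [ha, hb, add_zero]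
    exact (h0 _).trans (h0 _).symm

end Retract

/-! ### The sheaf property -/

section Sheaf

variable {k : Type u} [Field k] {X : TopCat.{u}}

lemma equivFinsuppOfBasisLeft_lTensor {κ W M N : Type*} [DecidableEq κ] [AddCommGroup W]
    [Module k W] [AddCommGroup M] [Module k M] [AddCommGroup N] [Module k N]
    (b : Module.Basis κ k W) (g : M →ₗ[k] N) (z : W ⊗[k] M) (c : κ) :
    TensorProduct.equivFinsuppOfBasisLeft (N := N) b (g.lTensor W z) c =
      g (TensorProduct.equivFinsuppOfBasisLeft (N := M) b z c) := by
  induction z with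
  | zero => simp
  | tmul x y => simp
  | add x y hx hy => simp [hx, hy]

lemma res_res {P : TopCat.Presheaf (ModuleCat.{u} k) X} {A B C : Opens X} (h : B ≤ A) (h' : C ≤ B)
    (x : P.obj (op A)) :
    P.map (homOfLE h').op (P.map (homOfLE h).op x) = P.map (homOfLE (h'.trans h)).op x := by
  rw [← ConcreteCategory.comp_apply, ← P.map_comp]
  rfl

/-- On a noetherian space, tensoring with a vector space preserves sheaves. -/
theorem isSheaf_tensorRestrict [NoetherianSpace X] (W : Type u) [AddCommGroup W] [Module k W]
    {P : TopCat.Presheaf (ModuleCat.{u} k) X} (hP : P.IsSheaf) (U : Opens X) :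
    (tensorRestrict W P U).IsSheaf := by
  classical
  rw [TopCat.Presheaf.isSheaf_iff_isSheafUniqueGluing]
  intro ι V sf hsf
  let b := Module.Basis.ofVectorSpace k W
  let E (O : Opens X) := TensorProduct.equivFinsuppOfBasisLeft (N := P.obj (op (O ⊓ U))) b
  have hE {O O' : Opens X} (h : O' ≤ O) (z : W ⊗[k] P.obj (op (O ⊓ U))) (c) :
      E O' ((tensorRestrict W P U).map (homOfLE h).op z) c =
        P.map (homOfLE (inf_le_inf_right U h)).op (E O z c) :=
    equivFinsuppOfBasisLeft_lTensor b _ z c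
  let PS : TopCat.Sheaf (ModuleCat.{u} k) X := ⟨P, hP⟩
  have hcover : iSup V ⊓ U ≤ ⨆ i, V i ⊓ U := (iSup_inf_eq V U).le
  have hle (i) : V i ⊓ U ≤ iSup V ⊓ U := inf_le_inf_right U (le_iSup V i)
  have hglue (c) : ∃! s : P.obj (op (iSup V ⊓ U)),
      ∀ i, P.map (homOfLE (hle i)).op s = E (V i) (sf i) c := by
    refine TopCat.Sheaf.existsUnique_gluing' PS (fun i ↦ V i ⊓ U) (iSup V ⊓ U)
      (fun i ↦ homOfLE (hle i)) hcover (fun i ↦ E (V i) (sf i) c) fun i j ↦ ?_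
    have h := hsf i j
    have h1 := hE (inf_le_left : V i ⊓ V j ≤ V i) (sf i) c
    have h2 := hE (inf_le_right : V i ⊓ V j ≤ V j) (sf j) c
    have h3 := h1.symm.trans ((congr_arg (fun z ↦ E (V i ⊓ V j) z c) h).trans h2)
    have hle' : (V i ⊓ U) ⊓ (V j ⊓ U) ≤ (V i ⊓ V j) ⊓ U := by
      rw [inf_inf_inf_comm, inf_idem]
    have h4 := congr_arg (P.map (homOfLE hle').op) h3
    rw [res_res, res_res] at h4
    exact h4
  choose s hs hs' using hglue
  -- The coordinates have been glued separately and could be nonzero infinitely often. A finite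
  -- subcover rules this out: a coordinate vanishing on each of its members vanishes.
  obtain ⟨I, hI⟩ : ∃ I : Finset ι, iSup V ≤ ⨆ i : I, V i := by
    obtain ⟨I, hI⟩ := (NoetherianSpace.isCompact (iSup V : Opens X).1).elim_finite_subcover
      (fun i ↦ (V i : Set X)) (fun i ↦ (V i).2) (by simp)
    refine ⟨I, fun x hx ↦ ?_⟩
    obtain ⟨i, hi, hx⟩ := Set.mem_iUnion₂.1 (hI hx)
    exact Opens.mem_iSup.2 ⟨⟨i, hi⟩, hx⟩
  let supp : Finset _ := I.biUnion fun i ↦ (E (V i) (sf i)).support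
  have hsupp (c) (hc : s c ≠ 0) : c ∈ supp := by
    by_contra hc'
    refine hc (TopCat.Sheaf.eq_of_locally_eq' PS (fun i : I ↦ V i ⊓ U) (iSup V ⊓ U)
      (fun i ↦ homOfLE (hle i)) ((inf_le_inf_right U hI).trans (iSup_inf_eq _ U).le) _ _
      fun i ↦ (hs c i).trans ?_)
    rw [map_zero]
    by_contra h
    exact hc' (Finset.mem_biUnion.2 ⟨i, i.2, Finsupp.mem_support_iff.2 h⟩)
  let S := Finsupp.onFinset supp s hsupp
  refine ⟨(E _).symm S, fun i ↦ ?_, fun z hz ↦ ?_⟩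
  · apply (E (V i)).injective
    ext c
    refine (hE (le_iSup V i) _ c).trans ?_
    rw [LinearEquiv.apply_symm_apply]
    exact hs c i
  · apply (E (iSup V)).injective
    ext c
    rw [LinearEquiv.apply_symm_apply]
    refine hs' c _ fun i ↦ ?_
    exact (hE (le_iSup V i) z c).symm.trans (congr_arg (fun z ↦ E (V i) z c) (hz i))

/-- A presheaf is a sheaf if its identity is a sum of morphisms factoring through sheaves. -/
theorem isSheaf_of_sum_comp_eq_id {P : TopCat.Presheaf (ModuleCat.{u} k) X} {ι : Type*} [Fintype ι]
    {T : ι → TopCat.Presheaf (ModuleCat.{u} k) X} (hT : ∀ p, (T p).IsSheaf)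
    (a : ∀ p, P ⟶ T p) (b : ∀ p, T p ⟶ P) (hab : ∑ p, a p ≫ b p = 𝟙 P) : P.IsSheaf := by
  have key {O : Opens X} (x : P.obj (op O)) :
      ∑ p, (b p).app (op O) ((a p).app (op O) x) = x := by
    have h := congr(($hab).app (op O))
    rw [NatTrans.app_sum] at h
    have h' := congr(($h).hom x)
    rw [ModuleCat.hom_sum, LinearMap.sum_apply] at h'
    exact h'
  rw [TopCat.Presheaf.isSheaf_iff_isSheafUniqueGluing]
  intro κ V sf hsf
  have hglue (p) := (hT p).isSheafUniqueGluing V (fun i ↦ (a p).app _ (sf i)) (fun i j ↦ by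
    have h := congr_arg ((a p).app (op (V i ⊓ V j))) (hsf i j)
    rw [NatTrans.naturality_apply, NatTrans.naturality_apply] at h
    exact h)
  choose s hs hs' using hglue
  -- Glue the images in each `T p`, then reassemble through the maps `b p`.
  refine ⟨∑ p, (b p).app _ (s p), fun i ↦ ?_, fun z hz ↦ ?_⟩
  · rw [map_sum, ← key (sf i)]
    refine Finset.sum_congr rfl fun p _ ↦ ?_
    have h : (T p).map (Opens.leSupr V i).op (s p) = (a p).app _ (sf i) := hs p i
    rw [← h, NatTrans.naturality_apply]
  · rw [← key z]
    refine Finset.sum_congr rfl fun p _ ↦ ?_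
    congr 1
    refine hs' p _ fun i ↦ ?_
    rw [← NatTrans.naturality_apply, hz i]

theorem isSheaf_presheafC [NoetherianSpace X] {r : ℕ} (U : Fin r → Opens X)
    (F : CochainComplex (TopCat.Presheaf (ModuleCat.{u} k) X) ℤ) (i : ℕ) (j : ℤ)
    (hF : (F.X j).IsSheaf) : (presheafC (cech U F) i j).IsSheaf :=
  isSheaf_of_sum_comp_eq_id (fun _ ↦ isSheaf_tensorRestrict _ hF _)
    (fun p : Σ n : Fin r, Fin (n.1 + 1) ↪o Fin r ↦ toTensorRestrict U F i j p.1 p.2) _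
    (sum_toTensorRestrict_comp_ofTensorRestrict U F i j)

end Sheaf

/-! ### Cohomology of open sets through `Ext` -/

section Ext

open Limits Abelian

/-- The Mayer–Vietoris argument: an `Ext` class that vanishes after pulling back to both pieces
is zero, if every class on the intersection is a sum of restrictions. -/
lemma ext_eq_zero_of_biprod {A : Type*} [Category* A] [Abelian A] [HasExt.{w} A] {P Q R M G : A}
    (f₁ : P ⟶ Q) (f₂ : P ⟶ R) (g₁ : Q ⟶ M) (g₂ : R ⟶ M)
    (zero : biprod.lift f₁ (-f₂) ≫ biprod.desc g₁ g₂ = 0)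
    (hS : (ShortComplex.mk _ _ zero).ShortExact) {n : ℕ} (x : Ext M G (n + 1))
    (h₁ : (Ext.mk₀ g₁).comp x (zero_add _) = 0) (h₂ : (Ext.mk₀ g₂).comp x (zero_add _) = 0)
    (h : ∀ z : Ext P G n, ∃ (a : Ext Q G n) (b : Ext R G n),
      z = (Ext.mk₀ f₁).comp a (zero_add n) + (Ext.mk₀ f₂).comp b (zero_add n)) : x = 0 := by
  obtain ⟨z, rfl⟩ := Ext.contravariant_sequence_exact₃ hS G x
    (Ext.biprod_ext
      (by rw [Ext.mk₀_comp_mk₀_assoc, Ext.comp_zero, biprod.inl_desc, h₁])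
      (by rw [Ext.mk₀_comp_mk₀_assoc, Ext.comp_zero, biprod.inr_desc, h₂])) (add_comm 1 n)
  obtain ⟨a, b, hab⟩ := h z
  -- The sign of `-f₂` is absorbed into `-b`. Thus `z` extends to the biproduct, and its connecting
  -- image is zero.
  have : z = (Ext.mk₀ (biprod.lift f₁ (-f₂))).comp
      ((Ext.mk₀ biprod.fst).comp a (zero_add n) +
        (Ext.mk₀ biprod.snd).comp (-b) (zero_add n)) (zero_add n) := by
    rw [hab, Ext.comp_add, Ext.mk₀_comp_mk₀_assoc, Ext.mk₀_comp_mk₀_assoc, biprod.lift_fst,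
      biprod.lift_snd, Ext.mk₀_neg, Ext.neg_comp, Ext.comp_neg, neg_neg]
  rw [this]
  exact hS.extClass_comp_assoc _

end Ext

section FreeSheaf

variable {X : TopCat.{u}}

variable (X) in
/-- Sheaves of abelian groups on a topological space. -/
abbrev AbSheaf : Type (u + 1) := Sheaf (Opens.grothendieckTopology X) AddCommGrpCat.{u}

variable (X) in
/-- The free abelian sheaf on the sheaf of sets represented by an open set. -/
abbrev freeSheaf : Opens X ⥤ AbSheaf X :=
  yoneda ⋙ (Functor.whiskeringRight _ _ _).obj AddCommGrpCat.free ⋙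
    presheafToSheaf (Opens.grothendieckTopology X) AddCommGrpCat.{u}

/-- Morphisms out of the free abelian sheaf on an open set are sections over it. -/
def freeSheafEquiv (V : Opens X) (G : AbSheaf X) :
    ((freeSheaf X).obj V ⟶ G) ≃ G.obj.obj (op V) :=
  ((sheafificationAdjunction (Opens.grothendieckTopology X) AddCommGrpCat.{u}).homEquiv _ _).trans
    (((AddCommGrpCat.adj.whiskerRight (Opens X)ᵒᵖ).homEquiv _ _).trans yonedaEquiv)

lemma freeSheafEquiv_comp {V : Opens X} {G G' : AbSheaf X}
    (φ : (freeSheaf X).obj V ⟶ G) (ψ : G ⟶ G') :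
    freeSheafEquiv V G' (φ ≫ ψ) = ψ.hom.app (op V) (freeSheafEquiv V G φ) :=
  rfl

lemma freeSheafEquiv_map_comp {V W : Opens X} {G : AbSheaf X}
    (g : W ⟶ V) (φ : (freeSheaf X).obj V ⟶ G) :
    freeSheafEquiv W G ((freeSheaf X).map g ≫ φ) = G.obj.map g.op (freeSheafEquiv V G φ) := by
  refine (congrArg
    (fun x ↦ yonedaEquiv ((AddCommGrpCat.adj.whiskerRight (Opens X)ᵒᵖ).homEquiv _ _ x))
    (Adjunction.homEquiv_naturality_left
      (sheafificationAdjunction (Opens.grothendieckTopology X) AddCommGrpCat.{u})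
      (((Functor.whiskeringRight _ _ _).obj AddCommGrpCat.free).map (yoneda.map g)) φ)).trans ?_
  refine (congrArg yonedaEquiv (Adjunction.homEquiv_naturality_left
     (AddCommGrpCat.adj.whiskerRight (Opens X)ᵒᵖ) (yoneda.map g) _)).trans ?_
  exact (yonedaEquiv_naturality _ _).symm

lemma freeSheafEquiv_add {V : Opens X} {G : AbSheaf X}
    (φ ψ : (freeSheaf X).obj V ⟶ G) :
    freeSheafEquiv V G (φ + ψ) = freeSheafEquiv V G φ + freeSheafEquiv V G ψ :=
  rfl

/-- Cohomology `H^n(V, G)` of an open set `V`. -/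
abbrev openH (G : AbSheaf X) (n : ℕ) (V : Opens X) : Type u :=
  Abelian.Ext ((freeSheaf X).obj V) G n

/-- Restriction of cohomology classes. -/
def openH.res {G : AbSheaf X} {n : ℕ} {V W : Opens X} (h : W ≤ V) :
    openH G n V →+ openH G n W :=
  (Abelian.Ext.mk₀ ((freeSheaf X).map (homOfLE h))).precomp G (zero_add n)

lemma openH.res_res {G : AbSheaf X} {n : ℕ} {V W W' : Opens X}
    (h : W ≤ V) (h' : W' ≤ W) (x : openH G n V) :
    openH.res h' (openH.res h x) = openH.res (h'.trans h) x := by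
  refine (Abelian.Ext.mk₀_comp_mk₀_assoc _ _ _).trans ?_
  rw [← Functor.map_comp]
  rfl

lemma openH.eq_zero_of_res_eq_zero {G : AbSheaf X} {n : ℕ} {A B : Opens X}
    (x : openH G (n + 1) (A ⊔ B)) (hA : openH.res le_sup_left x = 0)
    (hB : openH.res le_sup_right x = 0)
    (h : ∀ z : openH G n (A ⊓ B), ∃ (a : openH G n A) (b : openH G n B),
      z = openH.res inf_le_left a + openH.res inf_le_right b) : x = 0 := by
  exact ext_eq_zero_of_biprod _ _ _ _ _
    (Opens.mayerVietorisSquare A B).shortComplex_shortExact x hA hB h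

lemma openH.exists_add_of_section {G : AbSheaf X} {A B : Opens X}
    (h : ∀ z : G.obj.obj (op (A ⊓ B)), ∃ (a : G.obj.obj (op A)) (b : G.obj.obj (op B)),
      z = G.obj.map (homOfLE inf_le_left).op a + G.obj.map (homOfLE inf_le_right).op b)
    (z : openH G 0 (A ⊓ B)) : ∃ (a : openH G 0 A) (b : openH G 0 B),
      z = openH.res inf_le_left a + openH.res inf_le_right b := by
  obtain ⟨φ, rfl⟩ := (Abelian.Ext.mk₀_bijective _ _).2 z
  obtain ⟨a, b, hab⟩ := h (freeSheafEquiv _ _ φ)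
  refine ⟨Abelian.Ext.mk₀ ((freeSheafEquiv _ _).symm a),
    Abelian.Ext.mk₀ ((freeSheafEquiv _ _).symm b), ?_⟩
  have : φ = (freeSheaf X).map (homOfLE inf_le_left) ≫ (freeSheafEquiv A G).symm a +
      (freeSheaf X).map (homOfLE inf_le_right) ≫ (freeSheafEquiv B G).symm b := by
    apply (freeSheafEquiv _ _).injective
    rw [freeSheafEquiv_add, freeSheafEquiv_map_comp, freeSheafEquiv_map_comp,
      Equiv.apply_symm_apply, Equiv.apply_symm_apply, hab]
  rw [this, Abelian.Ext.mk₀_add, ← Abelian.Ext.mk₀_comp_mk₀, ← Abelian.Ext.mk₀_comp_mk₀]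
  rfl

/-- Dimension shifting: embed `G` in an injective sheaf, so that `x` is the connecting image of a
class of degree `n` on the quotient. In degree 0 that class is a section, which lifts locally; in
higher degree it dies locally by induction. -/
lemma openH.exists_res_eq_zero (n : ℕ) (G : AbSheaf X) {V : Opens X} (x : openH G (n + 1) V)
    (p : X) (hp : p ∈ V) : ∃ (W : Opens X) (h : W ≤ V), p ∈ W ∧ openH.res h x = 0 := by
  let S : ShortComplex (AbSheaf X) :=
    ShortComplex.mk (Injective.ι G) (Limits.cokernel.π _) (Limits.cokernel.condition _)
  have hS : S.ShortExact :=
    { exact := ShortComplex.exact_cokernel _ }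
  obtain ⟨y, rfl⟩ := Abelian.Ext.covariant_sequence_exact₁ _ hS x
    (Abelian.Ext.eq_zero_of_injective _) rfl
  cases n with
  | zero =>
    obtain ⟨ψ, rfl⟩ := (Abelian.Ext.mk₀_bijective _ _).2 y
    have := (Sheaf.isLocallySurjective_iff_epi' AddCommGrpCat.{u} S.g).mpr hS.epi_g
    obtain ⟨W, Wle : W ≤ V, ⟨t, ht⟩, hW⟩ :=
      (TopCat.Presheaf.isLocallySurjective_iff S.g.hom).mp this V
      (freeSheafEquiv _ _ ψ) p hp
    refine ⟨W, Wle, hW, ?_⟩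
    refine (Abelian.Ext.mk₀_comp_mk₀_assoc _ _ _).trans ?_
    have : (freeSheaf X).map (homOfLE Wle) ≫ ψ = (freeSheafEquiv _ _).symm t ≫ S.g := by
      apply (freeSheafEquiv _ _).injective
      rw [freeSheafEquiv_map_comp, freeSheafEquiv_comp, Equiv.apply_symm_apply]
      exact ht.symm
    rw [this, ← Abelian.Ext.mk₀_comp_mk₀_assoc]
    exact (congrArg ((Abelian.Ext.mk₀ _).comp · (zero_add 1)) hS.comp_extClass).trans
      (Abelian.Ext.comp_zero _ _ _ _ _)
  | succ m =>
    obtain ⟨W, h, hW, hy⟩ := openH.exists_res_eq_zero m S.X₃ y p hp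
    refine ⟨W, h, hW, ?_⟩
    refine (Abelian.Ext.comp_assoc _ _ _ (zero_add _) rfl (by omega)).symm.trans ?_
    exact (congrArg (Abelian.Ext.comp · hS.extClass rfl) hy).trans (Abelian.Ext.zero_comp _ _ _ _ _)
termination_by n

/-- The free abelian sheaf on the whole space is the constant sheaf `ℤ`. -/
def freeSheafTopIso : (freeSheaf X).obj ⊤ ≅
    (constantSheaf (Opens.grothendieckTopology X) AddCommGrpCat.{u}).obj (.of (ULift.{u} ℤ)) :=
  (presheafToSheaf _ _).mapIso (NatIso.ofComponents (fun V ↦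
    have : Unique ((yoneda.obj (⊤ : Opens X)).obj V) :=
      ⟨⟨homOfLE le_top⟩, fun _ ↦ Subsingleton.elim (α := (V.unop ⟶ ⊤)) _ _⟩
    AddEquiv.toAddCommGrpIso
      ((FreeAbelianGroup.uniqueEquiv ((yoneda.obj (⊤ : Opens X)).obj V)).trans AddEquiv.ulift.symm))
    (fun g ↦ by
      refine AddCommGrpCat.hom_ext (FreeAbelianGroup.lift_ext _ _ fun a ↦ ?_)
      change ULift.up (FreeAbelianGroup.lift (fun _ ↦ (1 : ℤ))
          (FreeAbelianGroup.map (fun b ↦ g.unop ≫ b) (FreeAbelianGroup.of a))) =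
        ULift.up (FreeAbelianGroup.lift (fun _ ↦ (1 : ℤ)) (FreeAbelianGroup.of a))
      simp))

lemma subsingleton_H_of_subsingleton_openH_top {G : AbSheaf X} {n : ℕ}
    (h : Subsingleton (openH G n ⊤)) : Subsingleton (Sheaf.H.{u} G n) := by
  refine ⟨fun x y ↦ ?_⟩
  have e : ∀ z : Sheaf.H.{u} G n, (Abelian.Ext.mk₀ (freeSheafTopIso (X := X)).inv).comp
      ((Abelian.Ext.mk₀ (freeSheafTopIso (X := X)).hom).comp z (zero_add n)) (zero_add n) = z :=
    fun z ↦ by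
    rw [Abelian.Ext.mk₀_comp_mk₀_assoc, Iso.inv_hom_id, Abelian.Ext.mk₀_id_comp]
  rw [← e x, ← e y]
  congr 1
  exact Subsingleton.elim (α := openH G n ⊤) _ _

end FreeSheaf

section OpenCohomology

variable {X : TopCat.{u}} {G : AbSheaf X}

lemma openH.res_zero_of_le {n : ℕ} {V W W' : Opens X} {x : openH G n V} {h : W ≤ V}
    (hx : openH.res h x = 0) (h' : W' ≤ W) : openH.res (h'.trans h) x = 0 := by
  rw [← openH.res_res h h', hx, map_zero]

lemma openH.eq_zero_of_cover {n : ℕ} {V A B : Opens X} (hA : A ≤ V) (hB : B ≤ V) (hV : V ≤ A ⊔ B)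
    (x : openH G (n + 1) V) (hxA : openH.res hA x = 0) (hxB : openH.res hB x = 0)
    (h : ∀ z : openH G n (A ⊓ B), ∃ (a : openH G n A) (b : openH G n B),
      z = openH.res inf_le_left a + openH.res inf_le_right b) : x = 0 := by
  obtain rfl : V = A ⊔ B := le_antisymm hV (sup_le hA hB)
  exact openH.eq_zero_of_res_eq_zero x hxA hxB h

lemma openH.eq_zero_of_res_of_le {n : ℕ} {V W : Opens X} {h : W ≤ V} {x : openH G n V}
    (hx : openH.res h x = 0) (h' : V ≤ W) : x = 0 := by
  obtain rfl : V = W := le_antisymm h' h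
  refine Eq.trans ?_ hx
  refine (Abelian.Ext.mk₀_id_comp x).symm.trans ?_
  rw [← (freeSheaf X).map_id]
  rfl

variable (G) in
-- A sheaf has only the zero section over the empty set, so the free sheaf on it has zero identity.
lemma openH.subsingleton_bot (n : ℕ) : Subsingleton (openH G n ⊥) := by
  have h : (𝟙 ((freeSheaf X).obj ⊥)) = 0 := by
    have : Subsingleton (((freeSheaf X).obj ⊥).obj.obj (op ⊥)) :=
      AddCommGrpCat.subsingleton_of_isZero
        (TopCat.Sheaf.isTerminalOfEmpty ((freeSheaf X).obj ⊥)).isZero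
    exact (freeSheafEquiv _ _).injective (Subsingleton.elim _ _)
  refine subsingleton_of_forall_eq 0 fun x ↦ ?_
  refine (Abelian.Ext.mk₀_id_comp x).symm.trans ?_
  rw [h, Abelian.Ext.mk₀_zero, Abelian.Ext.zero_comp]

end OpenCohomology

/-! ### Vanishing on affine opens and on unions of them -/

section Affine

variable {X : Scheme.{u}} {G : AbSheaf X}

/-- Vanishing of Čech `H¹` for two-element covers of affine opens by basic opens. -/
def IsAffineAcyclic (G : AbSheaf X) : Prop :=
  ∀ ⦃V : X.Opens⦄, IsAffineOpen V → ∀ f g : Γ(X, V), IsUnit (f + g) →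
    ∀ z : G.obj.obj (op (X.basicOpen f ⊓ X.basicOpen g)),
      ∃ (a : G.obj.obj (op (X.basicOpen f))) (b : G.obj.obj (op (X.basicOpen g))),
        z = G.obj.map (homOfLE inf_le_left).op a + G.obj.map (homOfLE inf_le_right).op b

/-- The functions `f` such that `x` vanishes on `D(f)` form an ideal, with Mayer–Vietoris giving
closure under sums. Since `x` dies locally, these `D(f)` cover `V`, so the ideal contains 1. -/
lemma IsAffineAcyclic.openH_eq_zero (hG : IsAffineAcyclic G) {n : ℕ} {V : X.Opens}
    (hV : IsAffineOpen V) (x : openH G (n + 1) V) : x = 0 := by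
  induction n using Nat.strong_induction_on generalizing V with
  | _ n ih =>
  have key ⦃V : X.Opens⦄ (hV : IsAffineOpen V) (f g : Γ(X, V)) (hfg : IsUnit (f + g))
      (x : openH G (n + 1) V) (hf : openH.res (X.basicOpen_le f) x = 0)
      (hg : openH.res (X.basicOpen_le g) x = 0) : x = 0 := by
    refine openH.eq_zero_of_cover _ _ ?_ x hf hg ?_
    · exact (X.basicOpen_of_isUnit hfg).ge.trans (X.basicOpen_add_le f g)
    -- The intersection `D(f) ∩ D(g) = D(fg)` is affine: degree 0 is the hypothesis on `G`, higher
    -- degrees vanish by induction.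
    · cases n with
      | zero => exact openH.exists_add_of_section (hG hV f g hfg)
      | succ m =>
        intro z
        refine ⟨0, 0, ?_⟩
        have : IsAffineOpen (X.basicOpen f ⊓ X.basicOpen g) := by
          rw [← X.basicOpen_mul]
          exact hV.basicOpen _
        rw [ih m (Nat.lt_succ_self m) this z, map_zero, map_zero, add_zero]
  let I : Ideal Γ(X, V) :=
    { carrier := {f | openH.res (X.basicOpen_le f) x = 0}
      zero_mem' := by
        have := openH.subsingleton_bot G (n + 1)
        rw [← X.basicOpen_zero V] at this
        exact Subsingleton.elim _ _
      add_mem' := fun {f g} hf hg ↦ by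
        -- On `D(f + g)` the restrictions of `f` and `g` have a unit as sum, so `key` applies there.
        set W := X.basicOpen (f + g)
        have hW : W ≤ V := X.basicOpen_le _
        have aux (f : Γ(X, V)) (hf : openH.res (X.basicOpen_le f) x = 0) :
            openH.res (X.basicOpen_le (X.presheaf.map (homOfLE hW).op f)) (openH.res hW x) = 0 := by
          rw [openH.res_res]
          exact openH.res_zero_of_le hf ((X.basicOpen_res f _).trans_le inf_le_right)
        refine key (hV.basicOpen _) (X.presheaf.map (homOfLE hW).op f)
          (X.presheaf.map (homOfLE hW).op g) ?_ _ (aux f hf) (aux g hg)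
        rw [← map_add]
        exact RingedSpace.isUnit_res_basicOpen _ _
      smul_mem' := fun r f hf ↦ openH.res_zero_of_le hf
        ((X.basicOpen_mul r f).trans_le inf_le_right) }
  have hI : I = ⊤ := by
    rw [← Ideal.span_eq I, ← hV.self_le_iSup_basicOpen_iff]
    intro p hp
    obtain ⟨W, hW, hpW, hx⟩ := openH.exists_res_eq_zero n G x p hp
    obtain ⟨f, hf, hpf⟩ := hV.exists_basicOpen_le ⟨p, hpW⟩ hp
    exact Opens.mem_iSup.2 ⟨⟨f, openH.res_zero_of_le hx hf⟩, hpf⟩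
  exact openH.eq_zero_of_res_of_le ((Ideal.eq_top_iff_one I).1 hI) (X.basicOpen_one (U := V)).ge

/-- By `hY`, `G` behaves like a direct image from `Y`, and `U` already contains the trace on `Y` of
every `V i`. Adding `V a` by Mayer–Vietoris creates no class: in degree 0 a section on the
intersection extends to `V a`, and in higher degrees the intersection is a union of the same shape
with one piece fewer than the new union. -/
lemma IsAffineAcyclic.openH_sup_eq_zero (hG : IsAffineAcyclic G)
    (hX : ∀ ⦃V W : X.Opens⦄, IsAffineOpen V → IsAffineOpen W → IsAffineOpen (V ⊓ W))
    {Y : X.Opens}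
    (hY : ∀ V : X.Opens, Function.Bijective (G.obj.map (homOfLE (inf_le_left : V ⊓ Y ≤ V)).op))
    {ι : Type*} (s : Finset ι) {U : X.Opens} (hU : IsAffineOpen U) (hUY : U ≤ Y)
    {V : ι → X.Opens} (hV : ∀ i, IsAffineOpen (V i)) (hVY : ∀ i, V i ⊓ Y ≤ U)
    {n : ℕ} (x : openH G (n + 1) (U ⊔ s.sup V)) : x = 0 := by
  classical
  induction s using Finset.induction_on generalizing U V n with
  | empty =>
    have : IsAffineOpen (U ⊔ (∅ : Finset ι).sup V) := by simpa using hU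
    exact hG.openH_eq_zero this x
  | insert a s _ ih =>
    refine openH.eq_zero_of_cover (A := U ⊔ s.sup V) (B := V a) ?_ ?_ ?_ x
      (ih hU hUY hV hVY _) (hG.openH_eq_zero (hV a) _) ?_
    · exact sup_le_sup_left (Finset.sup_mono (Finset.subset_insert a s)) _
    · exact (Finset.le_sup (Finset.mem_insert_self a s)).trans le_sup_right
    · rw [Finset.sup_insert, sup_assoc, sup_comm (s.sup V)]
    cases n with
    | zero =>
      refine openH.exists_add_of_section fun z ↦ ?_
      -- The whole trace of `V a` on `Y` lies in the intersection, so `z` determines a section over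
      -- `V a`; the two agree because they agree on `Y`.
      have hYA : V a ⊓ Y ≤ (U ⊔ s.sup V) ⊓ V a := le_inf ((hVY a).trans le_sup_left) inf_le_left
      obtain ⟨b, hb⟩ := (hY (V a)).2 (G.obj.map (homOfLE hYA).op z)
      refine ⟨0, b, (hY _).1 ?_⟩
      have h : (U ⊔ s.sup V) ⊓ V a ⊓ Y ≤ V a ⊓ Y := inf_le_inf_right Y inf_le_right
      replace hb := congrArg (G.obj.map (homOfLE h).op) hb
      rw [← CategoryTheory.comp_apply, ← CategoryTheory.comp_apply, ← Functor.map_comp,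
        ← Functor.map_comp] at hb
      rw [map_zero, zero_add, ← CategoryTheory.comp_apply, ← Functor.map_comp]
      exact hb.symm
    | succ m =>
      intro z
      refine ⟨0, 0, ?_⟩
      have e : (U ⊔ s.sup V) ⊓ V a = (U ⊓ V a) ⊔ s.sup (fun i ↦ V i ⊓ V a) := by
        rw [inf_sup_right, Finset.sup_inf_distrib_right]
      suffices ∀ z : openH G (m + 1) ((U ⊔ s.sup V) ⊓ V a), z = 0 by
        rw [this z, map_zero, map_zero, add_zero]
      rw [e]
      exact ih (hX hU (hV a)) (inf_le_left.trans hUY) (fun i ↦ hX (hV i) (hV a)) fun i ↦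
        le_inf ((inf_le_inf_right Y inf_le_left).trans (hVY i)) (inf_le_left.trans inf_le_right)

end Affine

/-! ### Splitting sections of quasi-coherent modules -/

section Quasicoherent

/-- Write `z = m/(fg)^n` and `p f^n + q g^n = 1`. Then `z = q (g^n z) + p (f^n z)`, where `g^n z =
m/f^n` comes from `A` and `f^n z = m/g^n` from `B`. -/
lemma exists_add_of_isLocalizedModule {R M A B D : Type*} [CommRing R] [AddCommGroup M]
    [AddCommGroup A] [AddCommGroup B] [AddCommGroup D] [Module R M] [Module R A] [Module R B]
    [Module R D] {f g : R} (hfg : IsUnit (f + g)) (α : M →ₗ[R] A) (β : M →ₗ[R] B) (δ : M →ₗ[R] D)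
    (hα : IsLocalizedModule (.powers f) α) (hβ : IsLocalizedModule (.powers g) β)
    (hδ : IsLocalizedModule (.powers (f * g)) δ) {a : A →ₗ[R] D} {b : B →ₗ[R] D}
    (ha : a ∘ₗ α = δ) (hb : b ∘ₗ β = δ) (z : D) : ∃ (x : A) (y : B), z = a x + b y := by
  obtain ⟨⟨m, s⟩, hm⟩ := IsLocalizedModule.surj (.powers (f * g)) δ z
  obtain ⟨_, n, rfl⟩ := s
  replace hm : (f * g) ^ n • z = δ m := hm
  obtain ⟨x, hx⟩ := ((Module.End.isUnit_iff _).1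
    (IsLocalizedModule.map_units (S := .powers f) α ⟨f ^ n, n, rfl⟩)).2 (α m)
  obtain ⟨y, hy⟩ := ((Module.End.isUnit_iff _).1
    (IsLocalizedModule.map_units (S := .powers g) β ⟨g ^ n, n, rfl⟩)).2 (β m)
  replace hx : f ^ n • x = α m := hx
  replace hy : g ^ n • y = β m := hy
  have inj : Function.Injective fun w : D ↦ (f * g) ^ n • w :=
    ((Module.End.isUnit_iff _).1
      (IsLocalizedModule.map_units (S := .powers (f * g)) δ ⟨(f * g) ^ n, n, rfl⟩)).1
  have hax : a x = g ^ n • z := inj <| by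
    have : f ^ n • a x = (f * g) ^ n • z := by rw [hm, ← map_smul, hx, ← ha]; rfl
    simp only
    rw [mul_pow, mul_comm, mul_smul, this, smul_comm, mul_pow, mul_comm]
  have hby : b y = f ^ n • z := inj <| by
    have : g ^ n • b y = (f * g) ^ n • z := by rw [hm, ← map_smul, hy, ← hb]; rfl
    simp only
    rw [mul_pow, mul_smul, this, mul_pow, smul_comm]
  have hco : IsCoprime (f ^ n) (g ^ n) := by
    refine IsCoprime.pow ?_
    obtain ⟨w, hw⟩ := hfg.exists_left_inv
    exact ⟨w, w, by rw [← mul_add, hw]⟩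
  obtain ⟨p, q, hpq⟩ := hco
  refine ⟨q • x, p • y, ?_⟩
  rw [map_smul, map_smul, hax, hby, smul_smul, smul_smul, ← add_smul, add_comm, hpq, one_smul]

lemma exists_add_of_isLocalizing {R : CommRingCat.{u}} (N : TopCat.Sheaf (ModuleCat R) (Spec R))
    (hN : IsLocalizing N) {f g : R} (hfg : IsUnit (f + g))
    (z : N.obj.obj (op (PrimeSpectrum.basicOpen (f * g)))) :
    ∃ (a : N.obj.obj (op (PrimeSpectrum.basicOpen f)))
      (b : N.obj.obj (op (PrimeSpectrum.basicOpen g))),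
      z = (N.obj.map (homOfLE (PrimeSpectrum.basicOpen_mul_le_left f g)).op).hom a +
        (N.obj.map (homOfLE (PrimeSpectrum.basicOpen_mul_le_right f g)).op).hom b := by
  have hres (e : R) (he : PrimeSpectrum.basicOpen (f * g) ≤ PrimeSpectrum.basicOpen e) :
      (N.obj.map (homOfLE he).op).hom ∘ₗ (N.obj.map (PrimeSpectrum.basicOpen e).leTop.op).hom =
        (N.obj.map (PrimeSpectrum.basicOpen (f * g)).leTop.op).hom :=
    congrArg ModuleCat.Hom.hom
      (N.obj.map_comp (PrimeSpectrum.basicOpen e).leTop.op (homOfLE he).op).symm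
  exact exists_add_of_isLocalizedModule hfg _ _ _ (hN f) (hN g) (hN (f * g))
    (hres f (PrimeSpectrum.basicOpen_mul_le_left f g))
    (hres g (PrimeSpectrum.basicOpen_mul_le_right f g)) z

/-- Čech `H¹` of a quasi-coherent sheaf vanishes for the cover of an affine open by two basic
opens. -/
lemma exists_add_of_isQuasicoherent {X : Scheme.{u}} (M : X.Modules) (hM : M.IsQuasicoherent)
    {Y : X.Opens} (hY : IsAffineOpen Y) {f g : Γ(X, Y)} (hfg : IsUnit (f + g)) {A B D : X.Opens}
    (hA : A = X.basicOpen f) (hB : B = X.basicOpen g) (hD : D = X.basicOpen (f * g))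
    (hDA : D ≤ A) (hDB : D ≤ B) (z : M.presheaf.obj (op D)) :
    ∃ (a : M.presheaf.obj (op A)) (b : M.presheaf.obj (op B)),
      z = M.presheaf.map (homOfLE hDA).op a + M.presheaf.map (homOfLE hDB).op b := by
  -- Keeping `A`, `B`, `D` as variables allows them to be replaced by images of basic opens of the
  -- spectrum, where the sections of the restricted module are localizations.
  rw [← hY.fromSpec_image_basicOpen] at hA hB hD
  subst hA hB hD
  have h := (isIso_fromTildeΓ_iff_isLocalizing (M.restrict hY.fromSpec)).1 inferInstance
  exact exists_add_of_isLocalizing _ h hfg z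

end Quasicoherent

/-! ### Cohomology of retracts -/

section Retracts

variable {k : Type u} [CommRing k] {X : TopCat.{u}}

/-- The underlying sheaf of abelian groups of a sheaf of modules. -/
abbrev toAbSheaf (P : TopCat.Presheaf (ModuleCat.{u} k) X) (hP : P.IsSheaf) : AbSheaf X :=
  (sheafCompose (Opens.grothendieckTopology X)
    (forget₂ (ModuleCat.{u} k) AddCommGrpCat.{u})).obj ⟨P, hP⟩

/-- The map induced on underlying sheaves of abelian groups. -/
def toAbSheafMap {P Q : TopCat.Presheaf (ModuleCat.{u} k) X} (hP : P.IsSheaf) (hQ : Q.IsSheaf)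
    (φ : P ⟶ Q) : toAbSheaf P hP ⟶ toAbSheaf Q hQ :=
  (sheafCompose (Opens.grothendieckTopology X) (forget₂ (ModuleCat.{u} k) AddCommGrpCat.{u})).map
    (X := ⟨P, hP⟩) (Y := ⟨Q, hQ⟩) ⟨φ⟩

/-- Cohomology is additive in the sheaf, so its identity map is a sum of maps factoring through zero
groups. -/
lemma subsingleton_cohomology_of_sum_comp_eq_id {P : TopCat.Presheaf (ModuleCat.{u} k) X}
    (hP : P.IsSheaf) {ι : Type*} [Fintype ι] {T : ι → TopCat.Presheaf (ModuleCat.{u} k) X}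
    (hT : ∀ p, (T p).IsSheaf) (a : ∀ p, P ⟶ T p) (b : ∀ p, T p ⟶ P)
    (hab : ∑ p, a p ≫ b p = 𝟙 P) {n : ℕ} (h : ∀ p, Subsingleton (cohomology ⟨T p, hT p⟩ n)) :
    Subsingleton (cohomology ⟨P, hP⟩ n) := by
  have hsum : ∑ p, toAbSheafMap hP (hT p) (a p) ≫ toAbSheafMap (hT p) hP (b p) = 𝟙 _ := by
    let Φ : (P ⟶ P) →+ (toAbSheaf P hP ⟶ toAbSheaf P hP) :=
      AddMonoidHom.mk' (toAbSheafMap hP hP) fun _ _ ↦ rfl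
    exact (map_sum Φ _ _).symm.trans (congrArg Φ hab)
  refine subsingleton_of_forall_eq 0 fun x ↦ ?_
  let Ψ : (toAbSheaf P hP ⟶ toAbSheaf P hP) →+ cohomology ⟨P, hP⟩ n :=
    AddMonoidHom.mk' (fun φ ↦ Sheaf.H.map φ n x) fun φ ψ ↦ Sheaf.H.map_add_apply φ ψ x
  refine (Sheaf.H.map_id_apply x).symm.trans (((congrArg Ψ hsum).symm.trans (map_sum Ψ _ _)).trans
    (Finset.sum_eq_zero fun p _ ↦ ?_))
  refine (Sheaf.H.map_comp_apply _ _ x).trans ?_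
  rw [(h p).elim (Sheaf.H.map (toAbSheafMap hP (hT p) (a p)) n x) 0, map_zero]

lemma subsingleton_cohomology_presheafC {k : Type u} [Field k] [NoetherianSpace X] {r : ℕ}
    (U : Fin r → Opens X) (F : CochainComplex (TopCat.Presheaf (ModuleCat.{u} k) X) ℤ) (i : ℕ)
    (j : ℤ) (hF : (F.X j).IsSheaf) {n : ℕ}
    (h : ∀ (m : ℕ) (σ : Fin (m + 1) ↪o Fin r), Subsingleton
      (cohomology ⟨_, isSheaf_tensorRestrict (APL.deg k m i) hF (inter U σ)⟩ n)) :
    Subsingleton (cohomology ⟨_, isSheaf_presheafC U F i j hF⟩ n) :=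
  subsingleton_cohomology_of_sum_comp_eq_id _ (fun _ ↦ isSheaf_tensorRestrict _ hF _)
    (fun p : Σ n : Fin r, Fin (n.1 + 1) ↪o Fin r ↦ toTensorRestrict U F i j p.1 p.2) _
    (sum_toTensorRestrict_comp_ofTensorRestrict U F i j) (fun p ↦ h _ p.2)

end Retracts

/-! ### The summands on a separated scheme of finite type -/

section Scheme

variable {k : Type u} [Field k] {X : Scheme.{u}} (f : X ⟶ Spec (CommRingCat.of k))

lemma isSheaf_toPresheafModuleCat (M : X.Modules) : ((toPresheafModuleCat f).obj M).IsSheaf := by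
  rw [TopCat.Presheaf.isSheaf_iff_isSheaf_comp (forget (ModuleCat k))]
  exact (TopCat.Presheaf.isSheaf_iff_isSheaf_comp (forget AddCommGrpCat) _).1 M.isSheaf

lemma isAffineOpen_inf [IsSeparated f] {V W : X.Opens} (hV : IsAffineOpen V)
    (hW : IsAffineOpen W) : IsAffineOpen (V ⊓ W) :=
  (isAffineHom_diagonal_iff (f := f)).mp inferInstance ⊤ (isAffineOpen_top _) V le_top W le_top
    hV hW

lemma isAffineOpen_inter [IsSeparated f] {r : ℕ} {U : Fin r → X.Opens}
    (hU : ∀ a, IsAffineOpen (U a)) {n : ℕ} (σ : Fin (n + 1) ↪o Fin r) :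
    IsAffineOpen (inter U σ) :=
  InfClosed.iInf_mem_of_nonempty (s := {V : X.Opens | IsAffineOpen V})
    (fun _ h _ h' ↦ isAffineOpen_inf f h h') fun a ↦ hU (σ a)

include f in
lemma noetherianSpace [LocallyOfFiniteType f] [QuasiCompact f] : NoetherianSpace X := by
  have := LocallyOfFiniteType.isLocallyNoetherian f
  have : CompactSpace X := QuasiCompact.compactSpace_of_compactSpace f
  have : AlgebraicGeometry.IsNoetherian X := {}
  infer_instance

/-- Restriction of sections of `V ↦ W ⊗ P(V ∩ U)` to `V ∩ U` is bijective. -/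
lemma bijective_tensorRestrict_map (W : Type u) [AddCommGroup W] [Module k W] {X : TopCat.{u}}
    (P : TopCat.Presheaf (ModuleCat.{u} k) X) (U V : Opens X) :
    Function.Bijective ((tensorRestrict W P U).map (homOfLE (inf_le_left : V ⊓ U ≤ V)).op) := by
  have : IsIso (homOfLE (inf_le_inf_right U (inf_le_left : V ⊓ U ≤ V))) :=
    ⟨homOfLE (le_inf le_rfl inf_le_right), rfl, rfl⟩
  have h := (ConcreteCategory.isIso_iff_bijective (P.map
    (homOfLE (inf_le_inf_right U (inf_le_left : V ⊓ U ≤ V))).op)).1 inferInstance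
  exact (LinearEquiv.lTensor W (LinearEquiv.ofBijective (P.map
    (homOfLE (inf_le_inf_right U (inf_le_left : V ⊓ U ≤ V))).op).hom h)).bijective

lemma exists_lTensor_add {W A B D : Type*} [AddCommGroup W] [AddCommGroup A] [AddCommGroup B]
    [AddCommGroup D] [Module k W] [Module k A] [Module k B] [Module k D] (p : A →ₗ[k] D)
    (q : B →ₗ[k] D) (h : ∀ z, ∃ a b, z = p a + q b) (z : W ⊗[k] D) :
    ∃ a b, z = p.lTensor W a + q.lTensor W b := by
  have hs : Function.Surjective (p.coprod q) := fun z ↦ by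
    obtain ⟨a, b, rfl⟩ := h z
    exact ⟨(a, b), rfl⟩
  obtain ⟨y, rfl⟩ := LinearMap.lTensor_surjective W hs z
  refine ⟨(LinearMap.fst k A B).lTensor W y, (LinearMap.snd k A B).lTensor W y, ?_⟩
  rw [← LinearMap.comp_apply, ← LinearMap.comp_apply, ← LinearMap.lTensor_comp,
    ← LinearMap.lTensor_comp, ← LinearMap.add_apply, ← LinearMap.lTensor_add,
    LinearMap.coprod]

variable [IsSeparated f] (W : Type u) [AddCommGroup W] [Module k W]
  {M : X.Modules} (hM : M.IsQuasicoherent) {U : X.Opens} (hU : IsAffineOpen U)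
  (hT : (tensorRestrict W ((toPresheafModuleCat f).obj M) U).IsSheaf)

include hM hU in
-- `V ∩ U` is affine by separatedness, and `D(s) ∩ U` is a basic open of it. The splitting for `M`
-- there survives tensoring with `W` by right exactness.
lemma isAffineAcyclic_tensorRestrict : IsAffineAcyclic (toAbSheaf _ hT) := by
  intro V hV s t hst z
  have hle : V ⊓ U ≤ V := inf_le_left
  have hs (s : Γ(X, V)) : X.basicOpen s ⊓ U = X.basicOpen (X.presheaf.map (homOfLE hle).op s) := by
    rw [X.basicOpen_res, inf_right_comm, inf_eq_right.2 (X.basicOpen_le s)]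
  have key := exists_add_of_isQuasicoherent M hM (isAffineOpen_inf f hV hU)
    (f := X.presheaf.map (homOfLE hle).op s) (g := X.presheaf.map (homOfLE hle).op t)
    (by rw [← map_add]; exact hst.map _) (hs s) (hs t)
    (D := X.basicOpen s ⊓ X.basicOpen t ⊓ U)
    (by rw [X.basicOpen_mul, ← hs, ← hs, inf_inf_distrib_right])
    (inf_le_inf_right U inf_le_left) (inf_le_inf_right U inf_le_right)
  exact exists_lTensor_add (((toPresheafModuleCat f).obj M).map _).hom
    (((toPresheafModuleCat f).obj M).map _).hom key z

include hM hU in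
lemma subsingleton_cohomology_tensorRestrict {r : ℕ} {V : Fin r → X.Opens}
    (hV : ∀ a, IsAffineOpen (V a)) (hcover : ⨆ a, V a = ⊤) (n : ℕ) :
    Subsingleton (cohomology ⟨_, hT⟩ (n + 1)) := by
  refine subsingleton_H_of_subsingleton_openH_top (subsingleton_of_forall_eq 0 ?_)
  -- Adjoining `U` to the cover provides the starting piece of the induction, which is run with `Y =
  -- U`.
  have h : (⊤ : X.Opens) = U ⊔ Finset.univ.sup (fun a ↦ V a) := by
    rw [Finset.sup_univ_eq_iSup, hcover, sup_top_eq]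
  rw [h]
  intro x
  refine (isAffineAcyclic_tensorRestrict f W hM hU hT).openH_sup_eq_zero
    (fun _ _ ↦ isAffineOpen_inf f) (Y := U) ?_ _ hU le_rfl hV (fun _ ↦ inf_le_right) x
  exact fun V ↦ bijective_tensorRestrict_map W _ U V

end Scheme

end ThomWhitney

end

theorem mainTheorem9 {k : Type u} [Field k] {X : Scheme.{u}} (f : X ⟶ Spec (CommRingCat.of k))
    [IsSeparated f] [LocallyOfFiniteType f] [QuasiCompact f]
    {r : ℕ} (U : Fin r → X.Opens) (hU : ∀ a, IsAffineOpen (U a)) (hcover : ⨆ a, U a = ⊤)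
    (F : CochainComplex X.Modules ℤ) (hF : ∀ j, (F.X j).IsQuasicoherent) (i : ℕ) (j : ℤ) :
    ∃ hsheaf : TopCat.Presheaf.IsSheaf (ThomWhitney.twPresheaf f U F i j),
      ∀ ℓ : ℕ, 1 ≤ ℓ →
        Subsingleton (ThomWhitney.cohomology ⟨ThomWhitney.twPresheaf f U F i j, hsheaf⟩ ℓ) := by
  have := ThomWhitney.noetherianSpace f
  have hP := ThomWhitney.isSheaf_toPresheafModuleCat f (F.X j)
  refine ⟨ThomWhitney.isSheaf_presheafC U _ i j hP, fun ℓ hℓ ↦ ?_⟩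
  obtain ⟨n, rfl⟩ := Nat.exists_eq_add_of_le' hℓ
  exact ThomWhitney.subsingleton_cohomology_presheafC U _ i j hP fun m σ ↦
    ThomWhitney.subsingleton_cohomology_tensorRestrict f _ (hF j)
      (ThomWhitney.isAffineOpen_inter f hU σ) _ hU hcover n
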